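/- Let $h\in\mathbb R[x_1,\dots,x_n]$ be hyperbolic with respect to $\mathbf e\in\mathbb R^n$, i.e. $h$ is homogeneous, $h(\mathbf e)\neq 0$, and for every $\mathbf x\in\mathbb R^n$ the polynomial $t\mapsto h(t\mathbf e-\mathbf x)$ has only real zeros. These zeros, counted with multiplicity, are the eigenvalues of $\mathbf x$. Let $\Lambda_{++}$ (resp. $\Lambda_+$) be the set of $\mathbf x$ all of whose eigenvalues are positive (resp. nonnegative), and let $\operatorname{rk}(\mathbf x)$ be the number of nonzero eigenvalues of $\mathbf x$. For $\mathbf v\in\mathbb R^n$ let $D_{\mathbf v}=\sum_k v_k\,\partial/\partial x_k$. For a positive integer $r$ let $U_r$ be the set of pairs $(\delta,\mu)$ of positive real numbers such that $$\delta-1\ \ge\ \frac{\delta}{\mu}\cdot\frac{\left(1+\frac{\delta}{r\mu}\right)^{r-1}-\left(\frac{\delta}{r\mu}\right)^{r-1}}{\left(1+\frac{\delta}{r\mu}\right)^{r}-\left(\frac{\delta}{r\mu}\right)^{r}}$$ and either $\mu>1$, or $1\le\delta\le 2$ and $\mu>1-\delta/r$. Let $U_\infty=\{(\delta,\mu):\delta>1,\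 \mu>0,\ \mu\ge\delta/(\delta-1)\}$. Let $\mathbf v_1,\dots,\mathbf v_m\in\Lambda_+$, write $\partial_k=D_{\mathbf v_k}$, and for a polynomial $g$ let $\xi_k[g]=g/\partial_k g$. Let $r$ be a positive integer or $r=\infty$, let $(\delta,\mu)\in U_r$, let $\mathbf x\in\Lambda_{++}$, and let $i,j\in\{1,\dots,m\}$ be such that $0<\operatorname{rk}(\mathbf v_j)\le r$, $0<\operatorname{rk}(\mathbf v_i)$ and $\xi_j[h](\mathbf x)\ge\mu$. Then $\partial_i h(\mathbf x)\ne 0$, $\partial_i(h-\partial_j h)(\mathbf x+\delta\mathbf v_j)\neq 0$, and $$\xi_i[h-\partial_j h](\mathbf x+\delta\mathbf v_j)\ \ge\ \xi_i[h](\mathbf x).$$ -/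

import Mathlib

namespace HypPoly

noncomputable section

/-- The univariate polynomial `t ↦ h (t • e - x)`. -/
def charPoly {n : ℕ} (h : MvPolynomial (Fin n) ℝ) (e x : Fin n → ℝ) : Polynomial ℝ :=
  MvPolynomial.aeval
    (fun k => Polynomial.C (e k) * Polynomial.X - Polynomial.C (x k)) h

/-- `h` is hyperbolic with respect to `e`: it is homogeneous, `h e ≠ 0`, and for every `x` all the
zeros of `t ↦ h (t • e - x)` are real (this polynomial is never zero, since its coefficient of
highest degree is `h e`, so having only real zeros means splitting over the reals). -/
def IsHyperbolic {n : ℕ} (h : MvPolynomial (Fin n) ℝ) (e : Fin n → ℝ) : Prop :=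
  (∃ d : ℕ, h.IsHomogeneous d) ∧ MvPolynomial.eval e h ≠ 0 ∧
    ∀ x : Fin n → ℝ, (charPoly h e x).Splits

/-- The eigenvalues of `x` with respect to `e`, with multiplicity. -/
def eigenvalues {n : ℕ} (h : MvPolynomial (Fin n) ℝ) (e x : Fin n → ℝ) : Multiset ℝ :=
  (charPoly h e x).roots

/-- The open hyperbolicity cone: the smallest eigenvalue is positive. -/
def openCone {n : ℕ} (h : MvPolynomial (Fin n) ℝ) (e : Fin n → ℝ) : Set (Fin n → ℝ) :=
  {x | ∀ l ∈ eigenvalues h e x, 0 < l}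

/-- The closed hyperbolicity cone: the smallest eigenvalue is nonnegative. -/
def closedCone {n : ℕ} (h : MvPolynomial (Fin n) ℝ) (e : Fin n → ℝ) : Set (Fin n → ℝ) :=
  {x | ∀ l ∈ eigenvalues h e x, 0 ≤ l}

/-- The rank of `x`: the number of nonzero eigenvalues, counted with multiplicity. -/
def rk {n : ℕ} (h : MvPolynomial (Fin n) ℝ) (e x : Fin n → ℝ) : ℕ :=
  ((eigenvalues h e x).filter (fun l => l ≠ 0)).card

/-- The directional derivative of the polynomial `h` in the direction `v`. -/
def dirDeriv {n : ℕ} (v : Fin n → ℝ) (h : MvPolynomial (Fin n) ℝ) : MvPolynomial (Fin n) ℝ :=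
  ∑ k, MvPolynomial.C (v k) * MvPolynomial.pderiv k h

/-- The rational function `g / D_v g`, as a function on `ℝⁿ`. -/
def xi {n : ℕ} (v : Fin n → ℝ) (g : MvPolynomial (Fin n) ℝ) (x : Fin n → ℝ) : ℝ :=
  MvPolynomial.eval x g / MvPolynomial.eval x (dirDeriv v g)

/-- The set `U_r` of pairs `(δ, μ)`, for a positive integer `r`. -/
def UFin (r : ℕ) : Set (ℝ × ℝ) :=
  {p | 0 < p.1 ∧ 0 < p.2 ∧
    p.1 - 1 ≥ p.1 / p.2 *
      (((1 + p.1 / (r * p.2)) ^ (r - 1) - (p.1 / (r * p.2)) ^ (r - 1)) /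
        ((1 + p.1 / (r * p.2)) ^ r - (p.1 / (r * p.2)) ^ r)) ∧
    (1 < p.2 ∨ (1 ≤ p.1 ∧ p.1 ≤ 2 ∧ 1 - p.1 / r < p.2))}

/-- The set `U_∞` of pairs `(δ, μ)`; here `δ > 1`, as `δ ≥ 1` holds on every `U_r`. -/
def UInf : Set (ℝ × ℝ) :=
  {p | 1 < p.1 ∧ 0 < p.2 ∧ p.2 ≥ p.1 / (p.1 - 1)}

/-- The set `U_r`, for `r` a positive integer or `r = ∞`. -/
def U (r : ℕ∞) : Set (ℝ × ℝ) :=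
  ENat.recTopCoe UInf UFin r

end

end HypPoly

/-! Restrict to the line t ↦ x + t v_j: let f be the restriction of h, g that of ∂_i h, and F = g/f.
The cone hypotheses make f real-rooted with negative roots and of degree rk(v_j) ≤ r (`splits_line`,
`natDegree_line_eq_rk`), and make F map the upper half-plane to the closed lower one
(`mapsDown_line`). Hence F = c₀ + ∑ c_ρ/(t - ρ) with c_ρ ≥ 0 (`MapsDown.partialFractions`).

With S = f'(δ)/f(δ), clearing denominators turns the claim into -F'(δ) ≤ (F(0) - F(δ))(1 - S). This
is linear in the c_ρ, so it suffices to check each pole. For a = -ρ it reads a/(δ + a) ≤ δ(1 - S),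
that is, δ ∑ 1/(δ + b) ≤ δ - 1 over the other roots -b. There are at most r - 1 of these and ∑ 1/b ≤
1/μ, so concavity bounds the sum by the case of equal b, and membership in U_r covers that case
(`sum_div_le_of_mem_U`).

The multivariate input is Gårding's theory of hyperbolicity cones, derived from one root-tracking
argument (`norm_eval_ge_of_path`). -/

namespace HypPoly
open MvPolynomial Filter Topology

noncomputable section

/-! ### Restriction of polynomials to lines -/

section Line
variable {K : Type*} [Field K] {n : ℕ}

/-- The restriction `t ↦ p (a + t • b)` of `p` to a line. -/
def line (p : MvPolynomial (Fin n) K) (a b : Fin n → K) : Polynomial K :=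
  aeval (fun k => Polynomial.C (a k) + Polynomial.C (b k) * Polynomial.X) p

theorem eval_line (p : MvPolynomial (Fin n) K) (a b : Fin n → K) (t : K) :
    (line p a b).eval t = eval (a + t • b) p := by
  unfold line
  induction p using MvPolynomial.induction_on with
  | C c => simp
  | add p q hp hq => simp [hp, hq]
  | mul_X p i hp => simp [hp]; left; ring

/-- The directional derivative over an arbitrary field. -/
def lineDeriv (v : Fin n → K) (p : MvPolynomial (Fin n) K) : MvPolynomial (Fin n) K :=
  ∑ k, C (v k) * pderiv k p

theorem lineDeriv_add (v : Fin n → K) (p q : MvPolynomial (Fin n) K) :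
    lineDeriv v (p + q) = lineDeriv v p + lineDeriv v q := by
  simp [lineDeriv, mul_add, Finset.sum_add_distrib]

theorem lineDeriv_sub (v : Fin n → K) (p q : MvPolynomial (Fin n) K) :
    lineDeriv v (p - q) = lineDeriv v p - lineDeriv v q := by
  simp [lineDeriv, mul_sub, Finset.sum_sub_distrib]

theorem lineDeriv_C_mul (v : Fin n → K) (c : K) (p : MvPolynomial (Fin n) K) :
    lineDeriv v (C c * p) = C c * lineDeriv v p := by
  simp only [lineDeriv, pderiv_C_mul, Finset.mul_sum]
  exact Finset.sum_congr rfl fun _ _ => by ring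

theorem lineDeriv_mul_X (v : Fin n → K) (p : MvPolynomial (Fin n) K) (i : Fin n) :
    lineDeriv v (p * X i) = lineDeriv v p * X i + C (v i) * p := by
  classical
  simp only [lineDeriv, pderiv_mul, pderiv_X, mul_add, Finset.sum_add_distrib, Finset.sum_mul,
    Pi.single_apply]
  congr 1
  · exact Finset.sum_congr rfl fun _ _ => by ring
  · simp

theorem derivative_line (p : MvPolynomial (Fin n) K) (a b : Fin n → K) :
    Polynomial.derivative (line p a b) = line (lineDeriv b p) a b := by
  induction p using MvPolynomial.induction_on with
  | C c => simp [line, lineDeriv]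
  | add p q hp hq =>
    rw [lineDeriv_add]; unfold line at *; simp [hp, hq]
  | mul_X p i hp =>
    rw [lineDeriv_mul_X]; unfold line at *; simp [hp]; ring

theorem lineDeriv_comm (v w : Fin n → K) (p : MvPolynomial (Fin n) K) :
    lineDeriv v (lineDeriv w p) = lineDeriv w (lineDeriv v p) := by
  induction p using MvPolynomial.induction_on with
  | C c => simp [lineDeriv]
  | add p q hp hq => simp only [lineDeriv_add, hp, hq]
  | mul_X p i hp =>
    simp only [lineDeriv_mul_X, lineDeriv_add, lineDeriv_C_mul, hp]; ring

theorem natDegree_line_le {d : ℕ} {p : MvPolynomial (Fin n) K} (hp : p.IsHomogeneous d)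
    (a b : Fin n → K) : (line p a b).natDegree ≤ d := by
  have := aeval_natDegree_le (m := d) (n := 1) p hp.totalDegree_le
    (fun k => Polynomial.C (a k) + Polynomial.C (b k) * Polynomial.X) (fun k => by
      compute_degree)
  rwa [mul_one] at this

theorem eval_smul_of_isHomogeneous {d : ℕ} {p : MvPolynomial (Fin n) K} (hp : p.IsHomogeneous d)
    (c : K) (x : Fin n → K) : eval (c • x) p = c ^ d * eval x p := by
  rw [eval_eq, eval_eq, Finset.mul_sum]
  refine Finset.sum_congr rfl fun m hm => ?_
  have hd : ∑ i ∈ m.support, m i = d := by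
    rw [← hp.degree_eq_sum_deg_support hm]
  simp only [Pi.smul_apply, smul_eq_mul, mul_pow, Finset.prod_mul_distrib, Finset.prod_pow_eq_pow_sum,
    hd]
  rw [mul_left_comm]

/-- By homogeneity p(a + t b) and p(b + t a) are reversals of each other in degree d, so the top
coefficient of one is the constant term of the other. -/
theorem coeff_line [Infinite K] {d : ℕ} {p : MvPolynomial (Fin n) K} (hp : p.IsHomogeneous d)
    (a b : Fin n → K) : (line p a b).coeff d = eval b p := by
  have key : (line p a b).reflect d = line p b a := by
    refine Polynomial.eq_of_infinite_eval_eq _ _ ?_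
    refine Set.Infinite.mono (s := {0}ᶜ) ?_ (Set.finite_singleton (0 : K)).infinite_compl
    intro t ht
    have ht : t ≠ 0 := by simpa using ht
    have : Invertible t⁻¹ := invertibleOfNonzero (inv_ne_zero ht)
    have := Polynomial.eval₂_reflect_mul_pow (RingHom.id K) t⁻¹ d (line p a b)
      (natDegree_line_le hp a b)
    rw [← Polynomial.eval, ← Polynomial.eval, eval_line, invOf_eq_inv, inv_inv] at this
    rw [Set.mem_ofPred_eq, eval_line, show b + t • a = t • (a + t⁻¹ • b) by
      rw [smul_add, smul_smul, mul_inv_cancel₀ ht, one_smul, add_comm],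
      eval_smul_of_isHomogeneous hp, ← this, mul_left_comm, ← mul_pow, mul_inv_cancel₀ ht]
    simp
  have h0 : ((line p a b).reflect d).coeff 0 = (line p b a).eval 0 := by
    rw [key, Polynomial.coeff_zero_eq_eval_zero]
  rw [Polynomial.coeff_reflect, eval_line] at h0
  simpa using h0

end Line

theorem dirDeriv_eq {n : ℕ} (v : Fin n → ℝ) (h : MvPolynomial (Fin n) ℝ) :
    dirDeriv v h = lineDeriv v h := rfl

variable {n : ℕ}

/-! ### Complex values of real polynomials -/

/-- A real vector viewed as a complex one. -/
def toC (x : Fin n → ℝ) : Fin n → ℂ := fun k => (x k : ℂ)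

/-- The value of a real polynomial at a complex point. -/
def cev (h : MvPolynomial (Fin n) ℝ) (z : Fin n → ℂ) : ℂ :=
  eval z (map Complex.ofRealHom h)

theorem cev_toC (h : MvPolynomial (Fin n) ℝ) (x : Fin n → ℝ) : cev h (toC x) = (eval x h : ℝ) := by
  unfold cev toC
  induction h using MvPolynomial.induction_on with
  | C c => simp
  | add p q hp hq => simp [hp, hq]
  | mul_X p i hp => simp [hp]

theorem cev_smul {d : ℕ} {h : MvPolynomial (Fin n) ℝ} (hh : h.IsHomogeneous d) (c : ℂ)
    (z : Fin n → ℂ) : cev h (c • z) = c ^ d * cev h z :=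
  eval_smul_of_isHomogeneous (hh.map _) c z

theorem continuous_cev (h : MvPolynomial (Fin n) ℝ) : Continuous (cev h) :=
  MvPolynomial.continuous_eval _

theorem eval_map_line (h : MvPolynomial (Fin n) ℝ) (a b : Fin n → ℝ) (z : ℂ) :
    ((line h a b).map Complex.ofRealHom).eval z = cev h (toC a + z • toC b) := by
  unfold line cev toC
  induction h using MvPolynomial.induction_on with
  | C c => simp
  | add p q hp hq => simp [hp, hq]
  | mul_X p i hp => simp [hp]; left; ring

theorem map_lineDeriv (v : Fin n → ℝ) (h : MvPolynomial (Fin n) ℝ) :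
    map Complex.ofRealHom (lineDeriv v h) = lineDeriv (toC v) (map Complex.ofRealHom h) := by
  simp [lineDeriv, toC, pderiv_map]

theorem charPoly_eq_line (h : MvPolynomial (Fin n) ℝ) (e x : Fin n → ℝ) :
    charPoly h e x = line h (-x) e := by
  have : (fun k => Polynomial.C (e k) * Polynomial.X - Polynomial.C (x k)) =
      fun k => Polynomial.C ((-x) k) + Polynomial.C (e k) * Polynomial.X := by
    funext k
    rw [Pi.neg_apply, Polynomial.C_neg]; ring
  rw [charPoly, line, this]

end
end HypPoly

/-! ### Root tracking and Gårding's theory of the hyperbolicity cone -/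

namespace HypPoly
open MvPolynomial Filter Topology

noncomputable section

/-- Each linear factor satisfies |z - w| ≥ φ(z) - φ(w) ≥ φ(z) at a root w. In the applications φ is
the real or the imaginary part. -/
theorem norm_eval_ge_of_roots {d : ℕ} {P : Polynomial ℂ} (hP : P.natDegree ≤ d)
    (hc : P.coeff d ≠ 0) (φ : ℂ →L[ℝ] ℝ) (hφ : ∀ z, |φ z| ≤ ‖z‖)
    (hr : ∀ z, P.eval z = 0 → φ z ≤ 0) {z : ℂ} (hz : 0 ≤ φ z) :
    ‖P.coeff d‖ * φ z ^ d ≤ ‖P.eval z‖ := by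
  have hd : P.natDegree = d := le_antisymm hP (Polynomial.le_natDegree_of_ne_zero hc)
  have hs := IsAlgClosed.splits P
  have hcard : P.roots.card = d := by rw [← hs.natDegree_eq_card_roots, hd]
  rw [hs.eval_eq_prod_roots z, norm_mul, Polynomial.leadingCoeff, hd]
  gcongr
  rw [← hcard]
  have hP0 : P ≠ 0 := by rintro rfl; simp at hc
  have hr' : ∀ w ∈ P.roots, φ w ≤ 0 := fun w hw => hr w ((Polynomial.mem_roots hP0).1 hw)
  clear hcard
  generalize P.roots = R at hr'
  induction R using Multiset.induction_on with
  | empty => simp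
  | cons w s ih =>
    simp only [Multiset.card_cons, Multiset.map_cons, Multiset.prod_cons, norm_mul, pow_succ']
    gcongr
    · calc φ z ≤ φ z - φ w := by linarith [hr' w (by simp)]
        _ = φ (z - w) := by simp
        _ ≤ _ := (le_abs_self _).trans (hφ _)
    · exact ih fun w hw => hr' w (by simp [hw])

/-- The roots z of p(A s + z a) cannot escape to infinity, the leading coefficient p(a) being
nonzero, and they never meet φ = 0; so they stay in φ < 0. Connectedness replaces continuity of
roots: `T` and `T'` are closed, cover `S`, and are disjoint on it. The conclusion is a lower bound
rather than nonvanishing so that it survives limits. -/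
theorem norm_eval_ge_of_path {n d : ℕ} {p : MvPolynomial (Fin n) ℂ} (hp : p.IsHomogeneous d)
    {a : Fin n → ℂ} (ha : eval a p ≠ 0) {A : ℝ → Fin n → ℂ} (hA : Continuous A)
    {S : Set ℝ} (hS : IsPreconnected S) (φ : ℂ →L[ℝ] ℝ) (hφ : ∀ z, |φ z| ≤ ‖z‖)
    (h0 : ∀ s ∈ S, ∀ z, eval (A s + z • a) p = 0 → φ z ≠ 0)
    {s₀ : ℝ} (hs₀ : s₀ ∈ S) (hs₀' : ∀ z, eval (A s₀ + z • a) p = 0 → φ z < 0)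
    {s : ℝ} (hs : s ∈ S) {z : ℂ} (hz : 0 ≤ φ z) :
    ‖eval a p‖ * φ z ^ d ≤ ‖eval (A s + z • a) p‖ := by
  have hbound : ∀ s, (∀ z, eval (A s + z • a) p = 0 → φ z ≤ 0) → ∀ z, 0 ≤ φ z →
      ‖eval a p‖ * φ z ^ d ≤ ‖eval (A s + z • a) p‖ := by
    intro s h z hz
    have := norm_eval_ge_of_roots (natDegree_line_le hp (A s) a)
      (by rwa [coeff_line hp]) φ hφ (fun z => by rw [eval_line]; exact h z) hz
    rwa [coeff_line hp, eval_line] at this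
  set T : Set ℝ := {s | ∀ z, 0 ≤ φ z → ‖eval a p‖ * φ z ^ d ≤ ‖eval (A s + z • a) p‖} with hT
  have hTc : IsClosed T := by
    have : T = ⋂ z : ℂ, ⋂ _ : 0 ≤ φ z,
        {s | ‖eval a p‖ * φ z ^ d ≤ ‖eval (A s + z • a) p‖} := by ext; simp [hT]
    rw [this]
    refine isClosed_iInter fun z => isClosed_iInter fun _ => isClosed_le continuous_const ?_
    exact ((MvPolynomial.continuous_eval p).comp (hA.add continuous_const)).norm
  set T' : Set ℝ := {s | ∃ z, 0 ≤ φ z ∧ eval (A s + z • a) p = 0} with hT'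
  have hT'c : IsClosed T' := by
    -- Compactify the root variable: (u, z) stands for the root z/u, and u = 0 is the point at
    -- infinity, excluded by p(a) ≠ 0.
    let k : Set (ℝ × ℂ) := {q | 0 ≤ q.1 ∧ q.1 + ‖q.2‖ = 1}
    have hk : IsCompact k := by
      refine Metric.isCompact_of_isClosed_isBounded ?_ ?_
      · exact (isClosed_le continuous_const continuous_fst).inter
          (isClosed_eq (continuous_fst.add continuous_snd.norm) continuous_const)
      · refine (Metric.isBounded_closedBall (x := (0 : ℝ × ℂ)) (r := 1)).subset ?_
        rintro ⟨u, z⟩ ⟨h1, h2⟩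
        simp only at h1 h2
        rw [mem_closedBall_zero_iff, Prod.norm_def, max_le_iff]
        exact ⟨by rw [Real.norm_eq_abs, abs_of_nonneg h1]; linarith [norm_nonneg z],
          by show ‖z‖ ≤ 1; linarith⟩
    have : CompactSpace k := isCompact_iff_compactSpace.1 hk
    have hcl := (isClosedMap_fst_of_compactSpace (X := ℝ) (Y := k))
      {q : ℝ × k | 0 ≤ φ q.2.1.2 ∧ eval ((q.2.1.1 : ℂ) • A q.1 + q.2.1.2 • a) p = 0} (by
        refine (isClosed_le (f := fun _ : ℝ × k => (0 : ℝ)) (g := fun q : ℝ × k => φ q.2.1.2)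
          continuous_const (by fun_prop)).inter
          (isClosed_eq ((MvPolynomial.continuous_eval p).comp ?_) continuous_const)
        fun_prop)
    convert hcl using 1
    ext s
    constructor
    · rintro ⟨z, hz, h⟩
      have hpos : 0 < 1 + ‖z‖ := by positivity
      refine ⟨(s, ⟨((1 + ‖z‖)⁻¹, ((1 + ‖z‖)⁻¹ : ℝ) • z), ⟨inv_nonneg.2 hpos.le, ?_⟩⟩), ⟨?_, ?_⟩, rfl⟩
      · show (1 + ‖z‖)⁻¹ + ‖((1 + ‖z‖)⁻¹ : ℝ) • z‖ = 1
        rw [norm_smul, Real.norm_eq_abs, abs_of_pos (inv_pos.2 hpos)]; field_simp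
      · show 0 ≤ φ (((1 + ‖z‖)⁻¹ : ℝ) • z)
        rw [map_smul]; exact smul_nonneg (by positivity) hz
      · have : (((1 + ‖z‖)⁻¹ : ℝ) : ℂ) • A s + (((1 + ‖z‖)⁻¹ : ℝ) • z) • a =
            (((1 + ‖z‖)⁻¹ : ℝ) : ℂ) • (A s + z • a) := by
          rw [smul_add, smul_smul, Complex.real_smul]
        show eval _ p = 0
        rw [this, eval_smul_of_isHomogeneous hp, h, mul_zero]
    · rintro ⟨⟨s, ⟨⟨u, z⟩, hu, huz⟩⟩, ⟨hz, h⟩, rfl⟩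
      simp only at hu huz hz h
      rcases hu.eq_or_lt with rfl | hu
      · exfalso
        have hz0 : z ≠ 0 := by rintro rfl; simp at huz
        simp only [Complex.ofReal_zero, zero_smul, zero_add, eval_smul_of_isHomogeneous hp] at h
        exact (mul_ne_zero (pow_ne_zero d hz0) ha) h
      · refine ⟨u⁻¹ • z, by rw [map_smul]; exact smul_nonneg (by positivity) hz, ?_⟩
        have hu' : (u : ℂ) ≠ 0 := by exact_mod_cast hu.ne'
        have : A s + (u⁻¹ • z) • a = (u : ℂ)⁻¹ • ((u : ℂ) • A s + z • a) := by
          rw [smul_add, smul_smul, smul_smul, inv_mul_cancel₀ hu', one_smul, Complex.real_smul]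
          push_cast; rfl
        rw [this, eval_smul_of_isHomogeneous hp, h, mul_zero]
  have hcov : S ⊆ T ∪ T' := by
    intro s _
    by_cases hs' : s ∈ T'
    · exact Or.inr hs'
    · refine Or.inl (hbound s fun z hz => ?_)
      by_contra hneg
      exact hs' ⟨z, by linarith, hz⟩
  have hemp : ¬ (S ∩ T').Nonempty := by
    intro hne
    obtain ⟨s, hsS, hsT, z, hz, hz0⟩ := (isPreconnected_closed_iff.1 hS) T T' hTc hT'c hcov
      ⟨s₀, hs₀, hbound s₀ fun z hz => (hs₀' z hz).le⟩ hne
    have h1 := hsT z hz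
    rw [hz0, norm_zero] at h1
    have : 0 < φ z := lt_of_le_of_ne hz (h0 s hsS z hz0).symm
    have : 0 < ‖eval a p‖ * φ z ^ d := by positivity
    linarith
  rcases hcov hs with h | h
  · exact h z hz
  · exact absurd ⟨s, hs, h⟩ hemp

variable {n d : ℕ} {h : MvPolynomial (Fin n) ℝ} {e : Fin n → ℝ}

theorem charPoly_ne_zero (hd : h.IsHomogeneous d) (hh : IsHyperbolic h e) (x : Fin n → ℝ) :
    charPoly h e x ≠ 0 := by
  intro h0
  have := coeff_line hd (-x) e
  rw [← charPoly_eq_line, h0, Polynomial.coeff_zero] at this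
  exact hh.2.1 this.symm

theorem toC_add (x y : Fin n → ℝ) : toC (x + y) = toC x + toC y := by ext; simp [toC]
theorem toC_neg (x : Fin n → ℝ) : toC (-x) = -toC x := by ext; simp [toC]
theorem toC_smul (c : ℝ) (x : Fin n → ℝ) : toC (c • x) = (c : ℂ) • toC x := by ext; simp [toC]

theorem exists_eigenvalue_of_cev_eq_zero (hd : h.IsHomogeneous d) (hh : IsHyperbolic h e)
    (x : Fin n → ℝ) {τ : ℂ} (hτ : cev h (toC x + τ • toC e) = 0) :
    ∃ l ∈ eigenvalues h e x, τ = -(l : ℂ) := by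
  have h1 : ((charPoly h e x).map Complex.ofRealHom).eval (-τ) = 0 := by
    rw [charPoly_eq_line, eval_map_line, toC_neg, show -toC x + -τ • toC e =
      (-1 : ℂ) • (toC x + τ • toC e) by module, cev_smul hd, hτ, mul_zero]
  have h0 : (charPoly h e x).map Complex.ofRealHom ≠ 0 :=
    (Polynomial.map_ne_zero_iff Complex.ofRealHom.injective).2 (charPoly_ne_zero hd hh x)
  have h2 : -τ ∈ ((charPoly h e x).map Complex.ofRealHom).roots := (Polynomial.mem_roots h0).2 h1
  rw [(hh.2.2 x).roots_map] at h2
  obtain ⟨l, hl, hl'⟩ := Multiset.mem_map.1 h2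
  exact ⟨l, hl, by rw [← neg_neg τ, ← hl']; rfl⟩

theorem cev_toC_ne_zero {x : Fin n → ℝ} : cev h (toC x) ≠ 0 ↔ eval x h ≠ 0 := by
  rw [cev_toC]; exact_mod_cast Iff.rfl

theorem mem_eigenvalues (hd : h.IsHomogeneous d) (hh : IsHyperbolic h e) {x : Fin n → ℝ} {l : ℝ} :
    l ∈ eigenvalues h e x ↔ eval (x - l • e) h = 0 := by
  rw [eigenvalues, Polynomial.mem_roots (charPoly_ne_zero hd hh x), Polynomial.IsRoot,
    charPoly_eq_line, eval_line, show -x + l • e = (-1 : ℝ) • (x - l • e) by module,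
    eval_smul_of_isHomogeneous hd]
  simp

theorem mem_openCone (hd : h.IsHomogeneous d) (hh : IsHyperbolic h e) {x : Fin n → ℝ} :
    x ∈ openCone h e ↔ ∀ t : ℝ, 0 ≤ t → eval (x + t • e) h ≠ 0 := by
  constructor
  · intro hx t ht h0
    have := hx (-t) ((mem_eigenvalues hd hh).2 (by simpa using h0))
    linarith
  · intro hx l hl
    by_contra hneg
    refine hx (-l) (by linarith) ?_
    rw [neg_smul, ← sub_eq_add_neg]; exact (mem_eigenvalues hd hh).1 hl

theorem mem_closedCone (hd : h.IsHomogeneous d) (hh : IsHyperbolic h e) {x : Fin n → ℝ} :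
    x ∈ closedCone h e ↔ ∀ t : ℝ, 0 < t → eval (x + t • e) h ≠ 0 := by
  constructor
  · intro hx t ht h0
    have := hx (-t) ((mem_eigenvalues hd hh).2 (by simpa using h0))
    linarith
  · intro hx l hl
    by_contra hneg
    refine hx (-l) (by linarith) ?_
    rw [neg_smul, ← sub_eq_add_neg]; exact (mem_eigenvalues hd hh).1 hl

theorem openCone_subset_closedCone : openCone h e ⊆ closedCone h e :=
  fun _ hx l hl => (hx l hl).le

theorem eval_ne_zero_of_mem_openCone (hd : h.IsHomogeneous d) (hh : IsHyperbolic h e)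
    {x : Fin n → ℝ} (hx : x ∈ openCone h e) : eval x h ≠ 0 := by
  simpa using (mem_openCone hd hh).1 hx 0 le_rfl

theorem smul_mem_openCone (hd : h.IsHomogeneous d) (hh : IsHyperbolic h e)
    {x : Fin n → ℝ} (hx : x ∈ openCone h e) {c : ℝ} (hc : 0 < c) : c • x ∈ openCone h e := by
  rw [mem_openCone hd hh] at hx ⊢
  intro t ht
  rw [show c • x + t • e = c • (x + (c⁻¹ * t) • e) by
    rw [smul_add, smul_smul, mul_inv_cancel_left₀ hc.ne'], eval_smul_of_isHomogeneous hd]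
  exact mul_ne_zero (pow_ne_zero _ hc.ne') (hx _ (by positivity))

theorem smul_mem_closedCone (hd : h.IsHomogeneous d) (hh : IsHyperbolic h e)
    {x : Fin n → ℝ} (hx : x ∈ closedCone h e) {c : ℝ} (hc : 0 < c) : c • x ∈ closedCone h e := by
  rw [mem_closedCone hd hh] at hx ⊢
  intro t ht
  rw [show c • x + t • e = c • (x + (c⁻¹ * t) • e) by
    rw [smul_add, smul_smul, mul_inv_cancel_left₀ hc.ne'], eval_smul_of_isHomogeneous hd]
  exact mul_ne_zero (pow_ne_zero _ hc.ne') (hx _ (by positivity))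

theorem mem_openCone_self (hd : h.IsHomogeneous d) (hh : IsHyperbolic h e) : e ∈ openCone h e := by
  rw [mem_openCone hd hh]
  intro t ht
  rw [show e + t • e = (1 + t) • e by module, eval_smul_of_isHomogeneous hd]
  exact mul_ne_zero (pow_ne_zero _ (by positivity)) hh.2.1

/-- Every element of the open cone is a direction of hyperbolicity, in quantitative form. -/
theorem norm_cev_ge (hd : h.IsHomogeneous d) (hh : IsHyperbolic h e) {a : Fin n → ℝ}
    (ha : a ∈ openCone h e) (y : Fin n → ℝ) {z : ℂ} (hz : 0 ≤ z.im) :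
    ‖cev h (toC a)‖ * z.im ^ d ≤ ‖cev h (toC y + z • toC a)‖ := by
  -- The shift by iα e keeps the roots off the real axis: a real root z would give the real vector s
  -- y + z a a nonreal eigenvalue. At s = 0 the roots are -iα/l with l > 0 an eigenvalue of a.
  -- Afterwards α → 0.
  have key : ∀ α : ℝ, 0 < α → ‖cev h (toC a)‖ * z.im ^ d ≤
      ‖cev h ((α * Complex.I) • toC e + toC y + z • toC a)‖ := by
    intro α hα
    have := norm_eval_ge_of_path (hd.map Complex.ofRealHom) (a := toC a)
      (cev_toC_ne_zero.2 (eval_ne_zero_of_mem_openCone hd hh ha))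
      (A := fun s => (α * Complex.I) • toC e + (s : ℂ) • toC y) (by fun_prop)
      (S := Set.univ) isPreconnected_univ Complex.imCLM (fun z => Complex.abs_im_le_norm z)
      (fun s _ z h0 hz => by
        have hz' : z = (z.re : ℂ) := Complex.ext rfl (by simpa using hz)
        rw [hz', add_assoc, ← toC_smul, ← toC_smul, ← toC_add, add_comm] at h0
        obtain ⟨l, -, hl⟩ := exists_eigenvalue_of_cev_eq_zero hd hh _ h0
        have := congrArg Complex.im hl
        simp at this
        exact hα.ne' this)
      (s₀ := 0) (Set.mem_univ _)
      (fun z h0 => by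
        have h0 : cev h ((α * Complex.I) • toC e + ((0 : ℝ) : ℂ) • toC y + z • toC a) = 0 := h0
        rw [Complex.ofReal_zero, zero_smul, add_zero] at h0
        have hαI : (α * Complex.I : ℂ) ≠ 0 := by simp [hα.ne']
        have hz : z ≠ 0 := by
          rintro rfl
          rw [zero_smul, add_zero, cev_smul hd] at h0
          exact mul_ne_zero (pow_ne_zero _ hαI) (cev_toC_ne_zero.2 hh.2.1) h0
        have h1 : cev h (toC a + (z⁻¹ * (α * Complex.I)) • toC e) = 0 := by
          rw [show toC a + (z⁻¹ * (α * Complex.I)) • toC e =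
            z⁻¹ • ((α * Complex.I) • toC e + z • toC a) by
              rw [smul_add, smul_smul, smul_smul, inv_mul_cancel₀ hz, one_smul, add_comm],
            cev_smul hd, h0, mul_zero]
        obtain ⟨l, hl, hl'⟩ := exists_eigenvalue_of_cev_eq_zero hd hh _ h1
        have hl0 : 0 < l := ha l hl
        have hz' : z = ((-(α / l) : ℝ) : ℂ) * Complex.I := by
          have hl1 : (l : ℂ) ≠ 0 := by exact_mod_cast hl0.ne'
          push_cast
          field_simp at hl' ⊢
          linear_combination hl'
        have : 0 < α / l := by positivity
        simpa [hz'] using this)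
      (s := 1) (Set.mem_univ _) (z := z) hz
    simpa [cev] using this
  refine ge_of_tendsto (x := 𝓝[>] (0 : ℝ)) (f := fun α : ℝ =>
    ‖cev h ((α * Complex.I) • toC e + toC y + z • toC a)‖) ?_
    (eventually_mem_nhdsWithin.mono fun α hα => key α hα)
  have hc : Continuous fun α : ℝ => ‖cev h ((α * Complex.I) • toC e + toC y + z • toC a)‖ :=
    ((continuous_cev h).comp (by fun_prop)).norm
  have := (hc.tendsto 0).mono_left (nhdsWithin_le_nhds (s := Set.Ioi 0))
  simpa using this

theorem cev_ne_zero_of_im_pos (hd : h.IsHomogeneous d) (hh : IsHyperbolic h e) {a : Fin n → ℝ}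
    (ha : a ∈ openCone h e) (y : Fin n → ℝ) {z : ℂ} (hz : 0 < z.im) :
    cev h (toC y + z • toC a) ≠ 0 := by
  have h1 := norm_cev_ge hd hh ha y hz.le
  have h2 := norm_pos_iff.2 (cev_toC_ne_zero.2 (eval_ne_zero_of_mem_openCone hd hh ha))
  have : 0 < ‖cev h (toC a)‖ * z.im ^ d := by positivity
  exact norm_pos_iff.1 (this.trans_le h1)

theorem cev_ne_zero_of_im_ne_zero (hd : h.IsHomogeneous d) (hh : IsHyperbolic h e) {a : Fin n → ℝ}
    (ha : a ∈ openCone h e) (y : Fin n → ℝ) {z : ℂ} (hz : z.im ≠ 0) :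
    cev h (toC y + z • toC a) ≠ 0 := by
  rcases hz.lt_or_gt with hz | hz
  · rw [show toC y + z • toC a = (-1 : ℂ) • (toC (-y) + (-z) • toC a) by rw [toC_neg]; module,
      cev_smul hd]
    exact mul_ne_zero (pow_ne_zero _ (by simp))
      (cev_ne_zero_of_im_pos hd hh ha (-y) (by simpa using hz))
  · exact cev_ne_zero_of_im_pos hd hh ha y hz

/-- Root tracking along e + s b + z a, with φ the real part: hyperbolicity in direction a excludes
nonreal z, and z = 0 is excluded because b is in the closed cone. Homogeneity then gives e any
weight u > 0, and u → 0 covers u = 0. This yields both stability of the open cone under addition and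
monotonicity of |h| along the cone. -/
theorem abs_eval_ge (hd : h.IsHomogeneous d) (hh : IsHyperbolic h e) {a b : Fin n → ℝ}
    (ha : a ∈ openCone h e) (hb : b ∈ closedCone h e) {u s t : ℝ} (hu : 0 ≤ u) (hs : 0 ≤ s)
    (ht : 0 ≤ t) : |eval a h| * t ^ d ≤ |eval (u • e + s • b + t • a) h| := by
  have key : ∀ s : ℝ, 0 ≤ s → ∀ t : ℝ, 0 ≤ t → |eval a h| * t ^ d ≤
      |eval (e + s • b + t • a) h| := by
    intro s hs t ht
    have := norm_eval_ge_of_path (hd.map Complex.ofRealHom) (a := toC a)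
      (cev_toC_ne_zero.2 (eval_ne_zero_of_mem_openCone hd hh ha))
      (A := fun s => toC e + (s : ℂ) • toC b) (by fun_prop)
      (S := Set.Ici 0) isPreconnected_Ici Complex.reCLM (fun z => Complex.abs_re_le_norm z)
      (fun s hs z h0 hz => by
        have hs : 0 ≤ s := hs
        by_cases him : z.im = 0
        · have hz0 : z = 0 := Complex.ext (by simpa using hz) him
          rw [hz0, zero_smul, add_zero, ← toC_smul, ← toC_add] at h0
          refine cev_toC_ne_zero.2 ?_ h0
          rcases hs.eq_or_lt with rfl | hs
          · simpa using hh.2.1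
          · rw [show e + s • b = s • (b + s⁻¹ • e) by
              rw [smul_add, smul_smul, mul_inv_cancel₀ hs.ne', one_smul, add_comm],
              eval_smul_of_isHomogeneous hd]
            exact mul_ne_zero (pow_ne_zero _ hs.ne')
              ((mem_closedCone hd hh).1 hb _ (inv_pos.2 hs))
        · rw [← toC_smul, ← toC_add] at h0
          exact cev_ne_zero_of_im_ne_zero hd hh ha _ him h0)
      (s₀ := 0) Set.self_mem_Ici
      (fun z h0 => by
        have h0 : cev h (toC e + ((0 : ℝ) : ℂ) • toC b + z • toC a) = 0 := h0
        rw [Complex.ofReal_zero, zero_smul, add_zero] at h0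
        have hz : z ≠ 0 := by
          rintro rfl
          rw [zero_smul, add_zero] at h0
          exact cev_toC_ne_zero.2 hh.2.1 h0
        have h1 : cev h (toC a + z⁻¹ • toC e) = 0 := by
          rw [show toC a + z⁻¹ • toC e = z⁻¹ • (toC e + z • toC a) by
              rw [smul_add, smul_smul, inv_mul_cancel₀ hz, one_smul, add_comm],
            cev_smul hd, h0, mul_zero]
        obtain ⟨l, hl, hl'⟩ := exists_eigenvalue_of_cev_eq_zero hd hh _ h1
        have hl0 : 0 < l := ha l hl
        have hz' : z = ((-(1 / l) : ℝ) : ℂ) := by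
          rw [← inv_inv z, hl']; push_cast; rw [one_div, inv_neg]
        rw [hz', Complex.reCLM_apply, Complex.ofReal_re]
        have : 0 < 1 / l := by positivity
        linarith)
      (s := s) (Set.mem_Ici.2 hs) (z := (t : ℂ)) (by simpa using ht)
    have h2 : ‖cev h (toC a)‖ * t ^ d ≤ ‖cev h (toC (e + s • b + t • a))‖ := by
      simpa [cev, toC_add, toC_smul] using this
    simpa [cev_toC] using h2
  have key2 : ∀ u : ℝ, 0 < u → |eval a h| * t ^ d ≤ |eval (u • e + s • b + t • a) h| := by
    intro u hu
    rw [show u • e + s • b + t • a = u • (e + (s / u) • b + (t / u) • a) by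
      simp only [smul_add, smul_smul, mul_div_cancel₀ _ hu.ne'], eval_smul_of_isHomogeneous hd,
      abs_mul, abs_of_pos (pow_pos hu d)]
    have := key (s / u) (by positivity) (t / u) (by positivity)
    calc |eval a h| * t ^ d = u ^ d * (|eval a h| * (t / u) ^ d) := by
          rw [div_pow]; field_simp
      _ ≤ _ := by gcongr
  rcases hu.eq_or_lt with rfl | hu
  · refine ge_of_tendsto (x := 𝓝[>] (0 : ℝ)) (f := fun u : ℝ =>
      |eval (u • e + s • b + t • a) h|) ?_
      (eventually_mem_nhdsWithin.mono fun u hu => key2 u hu)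
    have hc : Continuous fun u : ℝ => |eval (u • e + s • b + t • a) h| :=
      ((MvPolynomial.continuous_eval h).comp (by fun_prop)).abs
    exact (hc.tendsto 0).mono_left nhdsWithin_le_nhds
  · exact key2 u hu

theorem add_mem_openCone (hd : h.IsHomogeneous d) (hh : IsHyperbolic h e) {a b : Fin n → ℝ}
    (ha : a ∈ openCone h e) (hb : b ∈ closedCone h e) : a + b ∈ openCone h e := by
  rw [mem_openCone hd hh]
  intro t ht h0
  have := abs_eval_ge hd hh ha hb ht zero_le_one zero_le_one
  rw [one_smul, one_smul, show t • e + b + a = a + b + t • e by abel, h0, one_pow, mul_one,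
    abs_zero] at this
  exact abs_pos.2 (eval_ne_zero_of_mem_openCone hd hh ha) |>.not_ge this

end
end HypPoly

/-! ### Rational functions of Nevanlinna type in one variable -/

namespace HypPoly
open Filter Topology

noncomputable section

section Univariate
open Polynomial

/-- `g / f` maps the upper half-plane to the closed lower half-plane. -/
def MapsDown (f g : ℝ[X]) : Prop :=
  ∀ z : ℂ, 0 < z.im → ((g.map Complex.ofRealHom).eval z *
    (starRingEnd ℂ) ((f.map Complex.ofRealHom).eval z)).im ≤ 0

theorem eval_map_ofReal (f : ℝ[X]) (t : ℝ) :
    (f.map Complex.ofRealHom).eval (t : ℂ) = (f.eval t : ℝ) := by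
  simpa using eval_map_apply (f := Complex.ofRealHom) (p := f) t

/-- On the ray ρ + εω the product g · conj f is ε^m times a continuous function of ε; divide by ε^m
and let ε → 0. -/
theorem MapsDown.local_sign {f g q : ℝ[X]} (H : MapsDown f g) {ρ : ℝ} {m : ℕ}
    (hf : f = (X - C ρ) ^ m * q) {ω : ℂ} (hω : 0 < ω.im) :
    g.eval ρ * q.eval ρ * ((starRingEnd ℂ) ω ^ m).im ≤ 0 := by
  let F : ℝ → ℝ := fun ε => ((g.map Complex.ofRealHom).eval (ρ + ε * ω) *
    ((starRingEnd ℂ) ω ^ m * (starRingEnd ℂ) ((q.map Complex.ofRealHom).eval (ρ + ε * ω)))).im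
  have hF : ∀ ε : ℝ, 0 < ε → F ε ≤ 0 := by
    intro ε hε
    have h1 := H (ρ + ε * ω) (by simp; positivity)
    have h2 : (g.map Complex.ofRealHom).eval (ρ + ε * ω) *
        (starRingEnd ℂ) ((f.map Complex.ofRealHom).eval (ρ + ε * ω)) =
        ((ε ^ m : ℝ) : ℂ) * ((g.map Complex.ofRealHom).eval (ρ + ε * ω) *
        ((starRingEnd ℂ) ω ^ m *
          (starRingEnd ℂ) ((q.map Complex.ofRealHom).eval (ρ + ε * ω)))) := by
      rw [hf]
      simp [mul_pow]
      ring
    rw [h2, Complex.im_ofReal_mul] at h1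
    exact nonpos_of_mul_nonpos_right h1 (by positivity)
  have hc : Continuous F := by
    refine Complex.continuous_im.comp (Continuous.mul ?_ (continuous_const.mul
      (Complex.continuous_conj.comp ?_)))
    · exact (Polynomial.continuous _).comp (by fun_prop)
    · exact (Polynomial.continuous _).comp (by fun_prop)
  have h0 : F 0 ≤ 0 := le_of_tendsto (x := 𝓝[>] (0 : ℝ))
    ((hc.tendsto 0).mono_left nhdsWithin_le_nhds)
    (eventually_mem_nhdsWithin.mono fun ε hε => hF ε hε)
  simp only [F, Complex.ofReal_zero, zero_mul, add_zero, eval_map_ofReal] at h0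
  rw [Complex.conj_ofReal, show ((g.eval ρ : ℝ) : ℂ) * ((starRingEnd ℂ) ω ^ m * (q.eval ρ : ℝ)) =
    ((g.eval ρ * q.eval ρ : ℝ) : ℂ) * (starRingEnd ℂ) ω ^ m by push_cast; ring,
    Complex.im_ofReal_mul] at h0
  exact h0

theorem MapsDown.residue_nonneg {f g q : ℝ[X]} (H : MapsDown f g) {ρ : ℝ}
    (hf : f = (X - C ρ) * q) : 0 ≤ g.eval ρ * q.eval ρ := by
  have := H.local_sign (m := 1) (by simpa using hf) (ω := Complex.I) (by simp)
  simpa using this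

/-- A nonzero product would fix the sign of sin(mθ) on (0, π), but for m ≥ 2 the angles π/(2m) and
3π/(2m) both lie there and give opposite signs. -/
theorem MapsDown.eq_zero_of_two_le {f g q : ℝ[X]} (H : MapsDown f g) {ρ : ℝ} {m : ℕ} (hm : 2 ≤ m)
    (hf : f = (X - C ρ) ^ m * q) : g.eval ρ * q.eval ρ = 0 := by
  have hm' : (2 : ℝ) ≤ m := by exact_mod_cast hm
  have key : ∀ θ : ℝ, 0 < θ → θ < Real.pi →
      g.eval ρ * q.eval ρ * (-Real.sin (m * θ)) ≤ 0 := by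
    intro θ h1 h2
    have := H.local_sign hf (ω := Complex.exp (θ * Complex.I)) (by
      rw [Complex.exp_ofReal_mul_I_im]; exact Real.sin_pos_of_pos_of_lt_pi h1 h2)
    rwa [← map_pow, ← Complex.exp_nat_mul, Complex.conj_im, ← mul_assoc,
      show (m : ℂ) * θ = ((m * θ : ℝ) : ℂ) by push_cast; rfl, Complex.exp_ofReal_mul_I_im] at this
  have hpi := Real.pi_pos
  have h1 := key (Real.pi / 2 / m) (by positivity) (by rw [div_lt_iff₀ (by positivity)]; nlinarith)
  have h2 := key (3 * Real.pi / 2 / m) (by positivity)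
    (by rw [div_lt_iff₀ (by positivity)]; nlinarith)
  rw [mul_div_cancel₀ _ (by positivity), Real.sin_pi_div_two] at h1
  rw [mul_div_cancel₀ _ (by positivity), show 3 * Real.pi / 2 = Real.pi / 2 + Real.pi by ring,
    Real.sin_add_pi, Real.sin_pi_div_two] at h2
  linarith

theorem MapsDown.of_mul {f g : ℝ[X]} {ρ : ℝ} (H : MapsDown ((X - C ρ) * f) ((X - C ρ) * g)) :
    MapsDown f g := by
  intro z hz
  have h1 := H z hz
  have hne : z - ρ ≠ 0 := by
    intro h0
    have := congrArg Complex.im h0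
    simp at this
    exact hz.ne' this
  have h2 : (((X - C ρ) * g).map Complex.ofRealHom).eval z *
      (starRingEnd ℂ) ((((X - C ρ) * f).map Complex.ofRealHom).eval z) =
      ((Complex.normSq (z - ρ) : ℝ) : ℂ) * ((g.map Complex.ofRealHom).eval z *
        (starRingEnd ℂ) ((f.map Complex.ofRealHom).eval z)) := by
    rw [Complex.normSq_eq_conj_mul_self]
    simp
    ring
  rw [h2, Complex.im_ofReal_mul] at h1
  exact nonpos_of_mul_nonpos_right h1 (Complex.normSq_pos.2 hne)

/-- Without common real zeros, a multiple root of f would violate the sign condition, so all roots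
are simple. The expansion is Lagrange interpolation at these roots, and its coefficients are
residues, hence nonnegative. -/
theorem MapsDown.partialFractions_of_coprime {f g : ℝ[X]} (hs : f.Splits) (hf0 : f ≠ 0)
    (hdeg : g.natDegree ≤ f.natDegree) (H : MapsDown f g)
    (hco : ∀ ρ, f.eval ρ = 0 → g.eval ρ ≠ 0) :
    ∃ (R : Finset ℝ) (c : ℝ → ℝ) (c₀ : ℝ), (∀ ρ ∈ R, f.eval ρ = 0) ∧ (∀ ρ ∈ R, 0 ≤ c ρ) ∧
      ∀ t, f.eval t ≠ 0 → g.eval t = f.eval t * (c₀ + ∑ ρ ∈ R, c ρ / (t - ρ)) := by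
  have hnd : f.roots.Nodup := by
    rw [Multiset.nodup_iff_count_le_one]
    intro ρ
    by_contra! hcon
    obtain ⟨q, hq, hq'⟩ := exists_eq_pow_rootMultiplicity_mul_and_not_dvd f hf0 ρ
    rw [count_roots] at hcon
    have h1 := H.eq_zero_of_two_le hcon hq
    have hρ : f.eval ρ = 0 := (rootMultiplicity_pos hf0).1 (by omega)
    rcases mul_eq_zero.1 h1 with h1 | h1
    · exact hco ρ hρ h1
    · exact hq' (dvd_iff_isRoot.2 h1)
  let R := f.roots.toFinset
  have hlc : f.leadingCoeff ≠ 0 := leadingCoeff_ne_zero.2 hf0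
  have hf : f = C f.leadingCoeff * Lagrange.nodal R id := by
    conv_lhs => rw [hs.eq_prod_roots]
    rw [Lagrange.nodal_eq, Finset.prod, Multiset.toFinset_val, hnd.dedup]; rfl
  have hcard : R.card = f.natDegree := by
    rw [hs.natDegree_eq_card_roots, Multiset.toFinset_card_of_nodup hnd]
  have hmem : ∀ ρ, ρ ∈ R ↔ f.eval ρ = 0 := fun ρ => by simp [R, hf0]
  -- The limit of g/f at infinity, zero when g has smaller degree; subtracting c₀ f brings the
  -- degree below the number of nodes.
  let c₀ := g.coeff f.natDegree / f.leadingCoeff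
  have hG : (g - C c₀ * f).degree < R.card := by
    rw [hcard, degree_lt_iff_coeff_zero]
    intro k hk
    rcases hk.eq_or_lt with rfl | hk
    · simp only [coeff_sub, coeff_C_mul, c₀]
      rw [coeff_natDegree]; field_simp; ring
    · rw [coeff_sub, coeff_C_mul, coeff_eq_zero_of_natDegree_lt (hdeg.trans_lt hk),
        coeff_eq_zero_of_natDegree_lt hk]; simp
  have hI := Lagrange.eq_interpolate_of_eval_eq (s := R) (v := id) (r := fun ρ => g.eval ρ)
    Function.injective_id.injOn hG (fun ρ hρ => by
      have := (hmem ρ).1 hρ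
      simp [this])
  refine ⟨R, fun ρ => Lagrange.nodalWeight R id ρ * g.eval ρ / f.leadingCoeff, c₀,
    fun ρ hρ => (hmem ρ).1 hρ, ?_, ?_⟩
  · intro ρ hρ
    have hfac : f = (X - C ρ) * (C f.leadingCoeff * Lagrange.nodal (R.erase ρ) id) := by
      conv_lhs => rw [hf, Lagrange.nodal_eq_mul_nodal_erase hρ]
      simp only [id]; ring
    have h1 := H.residue_nonneg hfac
    rw [eval_mul, eval_C] at h1
    beta_reduce
    rw [Lagrange.nodalWeight_eq_eval_nodal_erase_inv]
    simp only [id]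
    set A := eval ρ (Lagrange.nodal (R.erase ρ) id)
    have : A⁻¹ * eval ρ g / f.leadingCoeff =
        (eval ρ g * (f.leadingCoeff * A)) * ((A⁻¹) ^ 2 * (f.leadingCoeff⁻¹) ^ 2) := by
      by_cases hA : A = 0
      · simp [hA]
      · field_simp
    rw [this]
    positivity
  · intro t ht
    have h1 := congrArg (eval t) hI
    rw [Lagrange.eval_interpolate_not_at_node _ (fun ρ hρ h => by
      subst h; exact ht ((hmem _).1 hρ))] at h1
    have h2 : eval t f = f.leadingCoeff * eval t (Lagrange.nodal R id) := by
      conv_lhs => rw [hf]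
      simp
    simp only [eval_sub, eval_mul, eval_C, id] at h1
    have h3 : eval t g = c₀ * eval t f + eval t (Lagrange.nodal R id) *
        ∑ ρ ∈ R, Lagrange.nodalWeight R id ρ * (t - ρ)⁻¹ * eval ρ g := by
      linarith
    have h4 : ∑ ρ ∈ R, Lagrange.nodalWeight R id ρ * (t - ρ)⁻¹ * eval ρ g =
        f.leadingCoeff * ∑ ρ ∈ R, Lagrange.nodalWeight R id ρ * eval ρ g / f.leadingCoeff /
          (t - ρ) := by
      rw [Finset.mul_sum]
      exact Finset.sum_congr rfl fun ρ hρ => by field_simp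
    rw [h3, h4, h2]; ring

/-- Partial fraction decomposition of a rational function of Nevanlinna type. -/
theorem MapsDown.partialFractions {f g : ℝ[X]} (hs : f.Splits) (hf0 : f ≠ 0)
    (hdeg : g.natDegree ≤ f.natDegree) (H : MapsDown f g) :
    ∃ (R : Finset ℝ) (c : ℝ → ℝ) (c₀ : ℝ), (∀ ρ ∈ R, f.eval ρ = 0) ∧ (∀ ρ ∈ R, 0 ≤ c ρ) ∧
      ∀ t, f.eval t ≠ 0 → g.eval t = f.eval t * (c₀ + ∑ ρ ∈ R, c ρ / (t - ρ)) := by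
  induction hN : f.natDegree generalizing f g with
  | zero =>
    refine H.partialFractions_of_coprime hs hf0 hdeg fun ρ hρ => ?_
    rw [eq_C_of_natDegree_eq_zero hN] at hρ hf0
    simp at hρ hf0
    exact absurd hρ hf0
  | succ N ih =>
    by_cases hco : ∀ ρ, f.eval ρ = 0 → g.eval ρ ≠ 0
    · exact H.partialFractions_of_coprime hs hf0 hdeg hco
    -- A common root is cancelled from both polynomials; this changes g · conj f only by the
    -- positive factor |z - ρ|².
    push Not at hco
    obtain ⟨ρ, hfρ, hgρ⟩ := hco
    obtain ⟨f', rfl⟩ := dvd_iff_isRoot.2 hfρ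
    obtain ⟨g', rfl⟩ := dvd_iff_isRoot.2 hgρ
    have hf0' : f' ≠ 0 := right_ne_zero_of_mul hf0
    have hX : (X - C ρ : ℝ[X]) ≠ 0 := X_sub_C_ne_zero ρ
    have hd : f'.natDegree = N := by
      rw [natDegree_mul hX hf0', natDegree_X_sub_C] at hN; omega
    have hdg : g'.natDegree ≤ f'.natDegree := by
      by_cases hg0 : g' = 0
      · simp [hg0]
      · rw [natDegree_mul hX hf0', natDegree_mul hX hg0] at hdeg; omega
    obtain ⟨R, c, c₀, h1, h2, h3⟩ := ih (splits_X_sub_C_mul_iff.1 hs) hf0' hdg H.of_mul hd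
    refine ⟨R, c, c₀, fun σ hσ => by simp [h1 σ hσ], h2, fun t ht => ?_⟩
    rw [eval_mul] at ht ⊢
    rw [eval_mul, h3 t (right_ne_zero_of_mul ht), mul_assoc]

/-! ### The scalar inequality behind U_r -/

theorem pow_add_le (u : ℝ) (hu : 0 ≤ u) (j : ℕ) :
    u ^ (j + 1) + (j + 1) * u ^ j ≤ (1 + u) ^ (j + 1) := by
  induction j with
  | zero => simp; linarith
  | succ j ih =>
    have h1 : (1 + u) * (u ^ (j + 1) + (j + 1) * u ^ j) ≤ (1 + u) * (1 + u) ^ (j + 1) := by gcongr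
    have h2 : 0 ≤ (j + 1) * u ^ j := by positivity
    calc u ^ (j + 1 + 1) + (((j + 1 : ℕ) : ℝ) + 1) * u ^ (j + 1)
        ≤ (1 + u) * (u ^ (j + 1) + (j + 1) * u ^ j) := by
          push_cast
          have : (1 + u) * (u ^ (j + 1) + (j + 1) * u ^ j) =
            u ^ (j + 1 + 1) + ((j + 1 : ℝ) + 1) * u ^ (j + 1) + (j + 1) * u ^ j := by ring
          linarith
      _ ≤ _ := by rw [pow_succ' (1 + u) (j + 1)]; exact h1

/-- With y = δ/b each term on the left is y/(1 + y); by concavity it lies below its tangent line at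
y = m. -/
theorem sum_div_le_tangent {δ m : ℝ} (hδ : 0 < δ) (hm : 0 ≤ m) (s : Multiset ℝ)
    (hs : ∀ b ∈ s, 0 < b) :
    δ * (s.map fun b => 1 / (δ + b)).sum ≤
      (s.card * m ^ 2 + δ * (s.map fun b => 1 / b).sum) / (1 + m) ^ 2 := by
  induction s using Multiset.induction_on with
  | empty => simp
  | cons b s ih =>
    have hb : 0 < b := hs b (by simp)
    have := ih fun b hb => hs b (by simp [hb])
    simp only [Multiset.map_cons, Multiset.sum_cons, Multiset.card_cons, Nat.cast_add, Nat.cast_one]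
    have h1 : δ * (1 / (δ + b)) ≤ (m ^ 2 + δ * (1 / b)) / (1 + m) ^ 2 := by
      rw [mul_one_div, mul_one_div, div_le_div_iff₀ (by positivity) (by positivity)]
      have : (m ^ 2 + δ / b) * (δ + b) - δ * (1 + m) ^ 2 = (m * b - δ) ^ 2 / b := by
        field_simp; ring
      have h2 : 0 ≤ (m * b - δ) ^ 2 / b := by positivity
      linarith
    calc _ = δ * (1 / (δ + b)) + δ * (s.map fun b => 1 / (δ + b)).sum := by ring
      _ ≤ _ := add_le_add h1 this
      _ = _ := by ring

theorem sum_div_le_of_mem_U {r : ℕ∞} (hr : 1 ≤ r) {δ μ : ℝ} (hU : (δ, μ) ∈ U r) (s : Multiset ℝ)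
    (hs : ∀ b ∈ s, 0 < b) (hcard : (s.card + 1 : ℕ∞) ≤ r)
    (hsum : (s.map fun b => 1 / b).sum ≤ 1 / μ) :
    δ * (s.map fun b => 1 / (δ + b)).sum ≤ δ - 1 := by
  induction r using ENat.recTopCoe with
  | top =>
    obtain ⟨h1, h2, h3⟩ : 1 < δ ∧ 0 < μ ∧ μ ≥ δ / (δ - 1) := hU
    have hδ : 0 < δ := by linarith
    have := sum_div_le_tangent hδ le_rfl s hs
    have h4 : δ * (1 / μ) ≤ δ - 1 := by
      rw [ge_iff_le, div_le_iff₀ (by linarith)] at h3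
      rw [mul_one_div, div_le_iff₀ h2]; linarith
    have h5 : δ * (s.map fun b => 1 / b).sum ≤ δ * (1 / μ) := by gcongr
    simp at this h5 h4 ⊢
    linarith
  | coe r =>
    obtain ⟨hδ, hμ, h3, -⟩ : 0 < δ ∧ 0 < μ ∧ δ - 1 ≥ δ / μ *
      (((1 + δ / (r * μ)) ^ (r - 1) - (δ / (r * μ)) ^ (r - 1)) /
        ((1 + δ / (r * μ)) ^ r - (δ / (r * μ)) ^ r)) ∧ _ := hU
    have hcard' : s.card + 1 ≤ r := by exact_mod_cast hcard
    obtain ⟨k, rfl⟩ : ∃ k, r = k + 1 := ⟨r - 1, by omega⟩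
    rw [Nat.add_sub_cancel] at h3
    -- For r = 1 the sum is empty, and the numerator in the definition of U_1 vanishes, which leaves
    -- δ ≥ 1.
    rcases k.eq_zero_or_pos with rfl | hk
    · have : s = 0 := Multiset.card_eq_zero.1 (by omega)
      simp [this] at h3 ⊢
      linarith
    obtain ⟨j, rfl⟩ : ∃ j, k = j + 1 := ⟨k - 1, by omega⟩
    set u := δ / (((j + 1 + 1 : ℕ) : ℝ) * μ) with hu
    have hu0 : 0 < u := by positivity
    have hY : δ / μ = (j + 2) * u := by rw [hu]; push_cast; field_simp; ring
    -- Here r = j + 2 and m = (δ/μ)/(r - 1), the common value of δ/b in the extremal case of r - 1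
    -- equal b with ∑ 1/b = 1/μ.
    set m := (j + 2) * u / (j + 1) with hm
    have hm0 : 0 < m := by positivity
    have h4 := sum_div_le_tangent hδ hm0.le s hs
    have hc : (s.card : ℝ) ≤ j + 1 := by
      have : s.card ≤ j + 1 := by omega
      exact_mod_cast this
    have h5 : (s.card * m ^ 2 + δ * (s.map fun b => 1 / b).sum) / (1 + m) ^ 2 ≤
        ((j + 1) * m ^ 2 + δ * (1 / μ)) / (1 + m) ^ 2 := by gcongr
    have h6 : ((j + 1) * m ^ 2 + δ * (1 / μ)) / (1 + m) ^ 2 = (j + 2) * u * (1 / (1 + m)) := by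
      rw [mul_one_div, hY, hm]; field_simp; ring
    -- The condition defining U_r is at least as strong as the extremal bound; after clearing
    -- denominators this is `pow_add_le`.
    have h7 : 1 / (1 + m) ≤ ((1 + u) ^ (j + 1) - u ^ (j + 1)) /
        ((1 + u) ^ (j + 1 + 1) - u ^ (j + 1 + 1)) := by
      have hp := pow_add_le u hu0.le j
      have hlt : u ^ (j + 1 + 1) < (1 + u) ^ (j + 1 + 1) := by gcongr; linarith
      rw [div_le_div_iff₀ (by positivity) (by linarith)]
      have : ((1 + u) ^ (j + 1) - u ^ (j + 1)) * (1 + m) -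
          1 * ((1 + u) ^ (j + 1 + 1) - u ^ (j + 1 + 1)) =
          u / (j + 1) * ((1 + u) ^ (j + 1) - (u ^ (j + 1) + (j + 1) * u ^ j)) := by
        rw [hm]; field_simp; ring
      have h8 : 0 ≤ u / (j + 1) * ((1 + u) ^ (j + 1) - (u ^ (j + 1) + (j + 1) * u ^ j)) :=
        mul_nonneg (by positivity) (by linarith)
      linarith
    have h8 : (j + 2) * u * (1 / (1 + m)) ≤ (j + 2) * u * (((1 + u) ^ (j + 1) - u ^ (j + 1)) /
        ((1 + u) ^ (j + 1 + 1) - u ^ (j + 1 + 1))) := by gcongr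
    rw [hY] at h3
    linarith

theorem pos_of_mem_U {r : ℕ∞} {δ μ : ℝ} (hU : (δ, μ) ∈ U r) : 0 < δ ∧ 0 < μ := by
  induction r using ENat.recTopCoe with
  | top =>
    obtain ⟨h1, h2, -⟩ : 1 < δ ∧ 0 < μ ∧ μ ≥ δ / (δ - 1) := hU
    exact ⟨by linarith, h2⟩
  | coe r =>
    obtain ⟨hδ, hμ, -⟩ : 0 < δ ∧ 0 < μ ∧ _ := hU
    exact ⟨hδ, hμ⟩

/-- Writing g = f F, the factor f(δ) cancels and only F and the logarithmic derivative of f remain;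
the inequality then splits over the poles of F. -/
theorem barrier_univariate {f g : ℝ[X]} (hs : f.Splits) (hneg : ∀ t, 0 ≤ t → f.eval t ≠ 0)
    (hdeg : g.natDegree ≤ f.natDegree) (H : MapsDown f g) {r : ℕ∞} (hr : 1 ≤ r)
    (hfr : (f.natDegree : ℕ∞) ≤ r) {δ μ : ℝ} (hU : (δ, μ) ∈ U r)
    (hμ : μ ≤ f.eval 0 / f.derivative.eval 0)
    (hg0 : 0 < g.eval 0 / f.eval 0) (hgδ : 0 < g.eval δ / f.eval δ) :
    g.eval δ - g.derivative.eval δ ≠ 0 ∧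
      f.eval 0 / g.eval 0 ≤
        (f.eval δ - f.derivative.eval δ) / (g.eval δ - g.derivative.eval δ) := by
  obtain ⟨hδ, hμ0⟩ := pos_of_mem_U hU
  have hf0 : f ≠ 0 := by rintro rfl; simpa using hneg 0 le_rfl
  have hroot : ∀ ρ, f.eval ρ = 0 → ρ < 0 := fun ρ hρ => by
    by_contra hcon; exact hneg ρ (by linarith) hρ
  have hfδ := hneg δ hδ.le
  have hf00 := hneg 0 le_rfl
  set s : Multiset ℝ := f.roots.map fun ρ => -ρ with hsdef
  have hspos : ∀ b ∈ s, 0 < b := by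
    intro b hb
    obtain ⟨ρ, hρ, rfl⟩ := Multiset.mem_map.1 hb
    linarith [hroot ρ ((mem_roots hf0).1 hρ)]
  have hscard : s.card = f.natDegree := by
    rw [hsdef, Multiset.card_map, hs.natDegree_eq_card_roots]
  have hdiv : ∀ t, 0 ≤ t → f.derivative.eval t / f.eval t = (s.map fun b => 1 / (t + b)).sum := by
    intro t ht
    rw [hs.eval_derivative_div_eval_of_ne_zero (hneg t ht), hsdef, Multiset.map_map]
    simp [sub_eq_add_neg]
  set S := (s.map fun b => 1 / (δ + b)).sum with hS
  have hfd : f.derivative.eval δ = f.eval δ * S := by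
    rw [hS, ← hdiv δ hδ.le]; field_simp
  have hsum0 : (s.map fun b => 1 / b).sum ≤ 1 / μ := by
    have h1 := hdiv 0 le_rfl
    simp only [zero_add] at h1
    rw [← h1, ← one_div_div]
    exact one_div_le_one_div_of_le hμ0 hμ
  -- Since a/(δ + a) + δ/(δ + a) = 1, removing the term of a from S leaves the bound for the other
  -- roots, of which there are at most r - 1.
  have hkey : ∀ a ∈ s, a / (δ + a) ≤ δ * (1 - S) := by
    intro a ha
    obtain ⟨s', hs'⟩ := Multiset.exists_cons_of_mem ha
    have ha0 := hspos a ha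
    have h1 := sum_div_le_of_mem_U hr hU s' (fun b hb => hspos b (by simp [hs', hb]))
      (by rw [← hscard, hs', Multiset.card_cons] at hfr; exact_mod_cast hfr)
      (by
        rw [hs', Multiset.map_cons, Multiset.sum_cons] at hsum0
        have : 0 < 1 / a := by positivity
        linarith)
    rw [hS, hs', Multiset.map_cons, Multiset.sum_cons]
    have h2 : a / (δ + a) + δ * (1 / (δ + a)) = 1 := by field_simp; ring
    linarith
  have hS1 : S < 1 := by
    -- Without roots f'(0) = 0, and the quotient bounding μ from above would be 0 by the convention
    -- for division by zero.
    have hne : s ≠ 0 := by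
      intro h0
      have h1 := hdiv 0 le_rfl
      rw [h0] at h1
      have h2 : f.derivative.eval 0 = 0 := by simpa [hf00] using h1
      rw [h2, div_zero] at hμ
      linarith
    obtain ⟨a, ha⟩ := Multiset.exists_mem_of_ne_zero hne
    have h1 := hkey a ha
    have ha0 := hspos a ha
    have h2 : 0 < a / (δ + a) := by positivity
    have h3 := pos_of_mul_pos_right (h2.trans_le h1) hδ.le
    linarith
  obtain ⟨R, c, c₀, hR, hc, hpf⟩ := H.partialFractions hs hf0 hdeg
  have hRs : ∀ ρ ∈ R, -ρ ∈ s := fun ρ hρ => Multiset.mem_map_of_mem _ ((mem_roots hf0).2 (hR ρ hρ))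
  let F : ℝ → ℝ := fun t => c₀ + ∑ ρ ∈ R, c ρ / (t - ρ)
  set E := ∑ ρ ∈ R, c ρ / (δ - ρ) ^ 2 with hE
  have hE0 : 0 ≤ E := Finset.sum_nonneg fun ρ hρ => div_nonneg (hc ρ hρ) (sq_nonneg _)
  have hF' : HasDerivAt F (-E) δ := by
    have : HasDerivAt F (0 + ∑ ρ ∈ R, -(c ρ / (δ - ρ) ^ 2)) δ := by
      refine (hasDerivAt_const δ c₀).add (HasDerivAt.fun_sum fun ρ hρ => ?_)
      have hne : δ - ρ ≠ 0 := by linarith [hroot ρ (hR ρ hρ)]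
      have := (((hasDerivAt_id δ).sub_const ρ).inv hne).const_mul (c ρ)
      exact (this.congr_deriv (by simp; ring)).congr_of_eventuallyEq
        (Eventually.of_forall fun t => div_eq_mul_inv _ _)
    rwa [zero_add, Finset.sum_neg_distrib] at this
  have hgd : g.derivative.eval δ = f.eval δ * S * F δ - f.eval δ * E := by
    have h1 : HasDerivAt (fun t => f.eval t * F t) (f.derivative.eval δ * F δ + f.eval δ * -E) δ :=
      (f.hasDerivAt δ).mul hF'
    have h2 : (fun t => f.eval t * F t) =ᶠ[𝓝 δ] fun t => g.eval t := by
      filter_upwards [lt_mem_nhds hδ] with t ht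
      exact (hpf t (hneg t ht.le)).symm
    have h3 := (h1.congr_of_eventuallyEq h2.symm).unique (g.hasDerivAt δ)
    rw [← h3, hfd]; ring
  have hgF : ∀ t, 0 ≤ t → g.eval t = f.eval t * F t := fun t ht => hpf t (hneg t ht)
  have hF0 : 0 < F 0 := by
    rwa [hgF 0 le_rfl, mul_div_cancel_left₀ _ hf00] at hg0
  have hFδ : 0 < F δ := by
    rwa [hgF δ hδ.le, mul_div_cancel_left₀ _ hfδ] at hgδ
  have hden : g.eval δ - g.derivative.eval δ = f.eval δ * (F δ * (1 - S) + E) := by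
    rw [hgF δ hδ.le, hgd]; ring
  have hD : 0 < F δ * (1 - S) + E := by
    have : 0 < F δ * (1 - S) := mul_pos hFδ (by linarith)
    linarith
  -- Pole by pole: both sides carry the nonnegative factor c_ρ/(-ρ(δ - ρ)), and what remains is
  -- `hkey` at -ρ.
  have hmain : E ≤ (F 0 - F δ) * (1 - S) := by
    have h1 : F 0 - F δ = ∑ ρ ∈ R, (c ρ / (0 - ρ) - c ρ / (δ - ρ)) := by
      simp only [F, Finset.sum_sub_distrib]; ring
    rw [h1, Finset.sum_mul, hE]
    refine Finset.sum_le_sum fun ρ hρ => ?_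
    have hρ0 := hroot ρ (hR ρ hρ)
    have h2 := hkey _ (hRs ρ hρ)
    have h3 : 0 < δ - ρ := by linarith
    have h4 : (0 : ℝ) < -ρ := by linarith
    have h5 : (c ρ / (0 - ρ) - c ρ / (δ - ρ)) * (1 - S) =
        c ρ / (-ρ * (δ - ρ)) * (δ * (1 - S)) := by
      rw [zero_sub, div_sub_div _ _ h4.ne' h3.ne']; ring
    have h6 : c ρ / (δ - ρ) ^ 2 = c ρ / (-ρ * (δ - ρ)) * (-ρ / (δ + -ρ)) := by
      have : δ + -ρ = δ - ρ := by ring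
      rw [this, sq, div_mul_div_comm, mul_comm (c ρ), mul_assoc (-ρ), mul_div_mul_left _ _ h4.ne']
    rw [h5, h6]
    exact mul_le_mul_of_nonneg_left h2 (div_nonneg (hc ρ hρ) (by positivity))
  refine ⟨by rw [hden]; exact mul_ne_zero hfδ hD.ne', ?_⟩
  rw [hden, hfd, show f.eval δ - f.eval δ * S = f.eval δ * (1 - S) by ring,
    mul_div_mul_left _ _ hfδ, hgF 0 le_rfl, div_mul_cancel_left₀ hf00, ← one_div,
    div_le_div_iff₀ hF0 hD]
  linarith

end Univariate
end
end HypPoly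

/-! ### From the hyperbolicity cone to the one-variable hypotheses -/

namespace HypPoly
open MvPolynomial Filter Topology

noncomputable section

variable {n d : ℕ} {h : MvPolynomial (Fin n) ℝ} {e : Fin n → ℝ}

/-- A nonreal root z would make z⁻¹ a nonreal root of s ↦ h(v + s x), contrary to hyperbolicity in
direction x. -/
theorem splits_line (hd : h.IsHomogeneous d) (hh : IsHyperbolic h e) {x : Fin n → ℝ}
    (hx : x ∈ openCone h e) (v : Fin n → ℝ) : (line h x v).Splits := by
  refine Polynomial.Splits.of_splits_map Complex.ofRealHom (IsAlgClosed.splits _) fun z hz => ?_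
  have h0 := (Polynomial.mem_roots'.1 hz).2
  rw [Polynomial.IsRoot, eval_map_line] at h0
  by_cases him : z.im = 0
  · exact ⟨z.re, Complex.ext rfl (by simp [him])⟩
  · exfalso
    have hz0 : z ≠ 0 := by rintro rfl; simp at him
    have hinv : z⁻¹.im ≠ 0 := by
      rw [Complex.inv_im]
      exact div_ne_zero (neg_ne_zero.2 him) (Complex.normSq_pos.2 hz0).ne'
    rw [show toC x + z • toC v = z • (toC v + z⁻¹ • toC x) by
      rw [smul_add, smul_smul, mul_inv_cancel₀ hz0, one_smul, add_comm], cev_smul hd] at h0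
    exact mul_ne_zero (pow_ne_zero _ hz0) (cev_ne_zero_of_im_ne_zero hd hh hx v hinv) h0

theorem add_smul_mem_openCone (hd : h.IsHomogeneous d) (hh : IsHyperbolic h e) {x v : Fin n → ℝ}
    (hx : x ∈ openCone h e) (hv : v ∈ closedCone h e) {t : ℝ} (ht : 0 ≤ t) :
    x + t • v ∈ openCone h e := by
  rcases ht.eq_or_lt with rfl | ht
  · simpa using hx
  · exact add_mem_openCone hd hh hx (smul_mem_closedCone hd hh hv ht)

theorem eval_line_ne_zero (hd : h.IsHomogeneous d) (hh : IsHyperbolic h e) {x v : Fin n → ℝ}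
    (hx : x ∈ openCone h e) (hv : v ∈ closedCone h e) {t : ℝ} (ht : 0 ≤ t) :
    (line h x v).eval t ≠ 0 := by
  rw [eval_line]
  exact eval_ne_zero_of_mem_openCone hd hh (add_smul_mem_openCone hd hh hx hv ht)

theorem abs_eval_le_abs_eval_add (hd : h.IsHomogeneous d) (hh : IsHyperbolic h e)
    {a b : Fin n → ℝ} (ha : a ∈ openCone h e) (hb : b ∈ closedCone h e) :
    |eval a h| ≤ |eval (a + b) h| := by
  have := abs_eval_ge hd hh ha hb le_rfl zero_le_one zero_le_one
  simpa [add_comm] using this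

theorem degree_le_of_abs_eval_le {P Q : Polynomial ℝ}
    (H : ∀ t, 0 ≤ t → |P.eval t| ≤ |Q.eval t|) : P.degree ≤ Q.degree := by
  by_contra! hlt
  have h1 := Polynomial.div_tendsto_atTop_zero_of_degree_lt Q P hlt
  have hP : P ≠ 0 := by rintro rfl; simp at hlt
  have h2 : ∀ᶠ t in atTop, 1 ≤ |Q.eval t / P.eval t| := by
    filter_upwards [Polynomial.eventually_atTop_not_isRoot P hP, eventually_ge_atTop 0] with t h1 h2
    rw [abs_div, le_div_iff₀ (abs_pos.2 h1), one_mul]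
    exact H t h2
  have h3 := ge_of_tendsto h1.abs h2
  simp at h3
  linarith

theorem natDegree_line_smul (hd : h.IsHomogeneous d) {c : ℝ} (hc : c ≠ 0) (y v : Fin n → ℝ) :
    (line h (c • y) v).natDegree = (line h y v).natDegree := by
  have : line h (c • y) v = Polynomial.C (c ^ d) *
      (line h y v).comp (Polynomial.C c⁻¹ * Polynomial.X) := by
    refine Polynomial.funext fun t => ?_
    simp only [Polynomial.eval_mul, Polynomial.eval_C, Polynomial.eval_comp, Polynomial.eval_X,
      eval_line]
    rw [← eval_smul_of_isHomogeneous hd, smul_add, smul_smul, mul_inv_cancel_left₀ hc]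
  rw [this, Polynomial.natDegree_C_mul (pow_ne_zero _ hc), Polynomial.natDegree_comp,
    Polynomial.natDegree_C_mul_X _ (inv_ne_zero hc), mul_one]

/-- Adding the cone vector c y - x cannot decrease |h| along the line, and growth at infinity
compares degrees; the rescaling by c does not change them. -/
theorem natDegree_line_le_of_sub_mem (hd : h.IsHomogeneous d) (hh : IsHyperbolic h e)
    {x y v : Fin n → ℝ} (hx : x ∈ openCone h e) (hv : v ∈ closedCone h e) {c : ℝ} (hc : 0 < c)
    (hcy : c • y - x ∈ openCone h e) :
    (line h x v).natDegree ≤ (line h y v).natDegree := by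
  rw [← natDegree_line_smul hd hc.ne' y v]
  refine Polynomial.natDegree_le_natDegree (degree_le_of_abs_eval_le fun t ht => ?_)
  rw [eval_line, eval_line, show c • y + t • v = x + t • v + (c • y - x) by abel]
  exact abs_eval_le_abs_eval_add hd hh (add_smul_mem_openCone hd hh hx hv ht)
    (openCone_subset_closedCone hcy)

theorem eigenvalues_card (hd : h.IsHomogeneous d) (hh : IsHyperbolic h e) (x : Fin n → ℝ) :
    (eigenvalues h e x).card = d ∧ (charPoly h e x).leadingCoeff = eval e h := by
  have h1 : (charPoly h e x).coeff d = eval e h := by rw [charPoly_eq_line, coeff_line hd]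
  have h2 : (charPoly h e x).natDegree = d :=
    le_antisymm (by rw [charPoly_eq_line]; exact natDegree_line_le hd _ _)
      (Polynomial.le_natDegree_of_ne_zero (by rw [h1]; exact hh.2.1))
  exact ⟨by rw [eigenvalues, ← (hh.2.2 x).natDegree_eq_card_roots, h2],
    by rw [Polynomial.leadingCoeff, h2, h1]⟩

theorem line_eq_prod_eigenvalues (hd : h.IsHomogeneous d) (hh : IsHyperbolic h e)
    (v : Fin n → ℝ) : line h e v = Polynomial.C (eval e h) *
      ((eigenvalues h e v).map fun l => Polynomial.C l * Polynomial.X + Polynomial.C 1).prod := by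
  refine Polynomial.eq_of_infinite_eval_eq _ _ ?_
  refine Set.Infinite.mono (s := {0}ᶜ) ?_ (Set.finite_singleton (0 : ℝ)).infinite_compl
  intro t ht
  have ht : t ≠ 0 := by simpa using ht
  obtain ⟨hcard, hlc⟩ := eigenvalues_card hd hh v
  have h1 := (hh.2.2 v).eval_eq_prod_roots (-t⁻¹)
  rw [hlc, charPoly_eq_line, eval_line, show -v + -t⁻¹ • e = (-t⁻¹) • (e + t • v) by
    rw [smul_add, smul_smul, neg_mul, inv_mul_cancel₀ ht]; module,
    eval_smul_of_isHomogeneous hd, ← charPoly_eq_line] at h1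
  change _ = _ * ((eigenvalues h e v).map _).prod at h1
  rw [Set.mem_ofPred_eq, eval_line, Polynomial.eval_mul, Polynomial.eval_C,
    Polynomial.eval_multiset_prod, Multiset.map_map]
  have h2 : ((eigenvalues h e v).map fun l => -t⁻¹ - l).prod = (-t⁻¹) ^ d *
      ((eigenvalues h e v).map
        (Polynomial.eval t ∘ fun l => Polynomial.C l * Polynomial.X + Polynomial.C 1)).prod := by
    rw [← hcard, ← Multiset.prod_replicate, ← Multiset.map_const', ← Multiset.prod_map_mul]
    congr 1
    refine Multiset.map_congr rfl fun l _ => ?_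
    simp
    field_simp
    ring
  rw [h2] at h1
  have h3 : (-t⁻¹) ^ d ≠ 0 := pow_ne_zero _ (neg_ne_zero.2 (inv_ne_zero ht))
  exact mul_left_cancel₀ h3 (by rw [h1]; ring)

/-- In the factorization h(e + t v) = h(e) ∏ (1 + l t), exactly the nonzero eigenvalues contribute
to the degree. -/
theorem natDegree_line_self (hd : h.IsHomogeneous d) (hh : IsHyperbolic h e) (v : Fin n → ℝ) :
    (line h e v).natDegree = rk h e v := by
  rw [line_eq_prod_eigenvalues hd hh, Polynomial.natDegree_C_mul hh.2.1, rk]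
  induction eigenvalues h e v using Multiset.induction_on with
  | empty => simp
  | cons l s ih =>
    have h0 : ∀ l : ℝ, (Polynomial.C l * Polynomial.X + Polynomial.C 1 : Polynomial ℝ) ≠ 0 := by
      intro l hl
      simpa using congrArg (Polynomial.eval 0) hl
    have hs : (s.map fun l => (Polynomial.C l * Polynomial.X + Polynomial.C 1 :
        Polynomial ℝ)).prod ≠ 0 := by
      refine Multiset.prod_ne_zero fun hmem => ?_
      obtain ⟨l, -, hl⟩ := Multiset.mem_map.1 hmem
      exact h0 l hl
    rw [Multiset.map_cons, Multiset.prod_cons, Polynomial.natDegree_mul (h0 l) hs, ih]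
    by_cases hl : l = 0
    · rw [Multiset.filter_cons_of_neg _ (by simpa using hl), hl]; simp
    · rw [Multiset.filter_cons_of_pos (p := fun l : ℝ => l ≠ 0) _ hl, Polynomial.natDegree_linear hl, Multiset.card_cons,
        add_comm]

theorem exists_pos_le_of_forall_pos (s : Multiset ℝ) (hs : ∀ l ∈ s, 0 < l) :
    ∃ c > 0, ∀ l ∈ s, c ≤ l := by
  induction s using Multiset.induction_on with
  | empty => exact ⟨1, one_pos, by simp⟩
  | cons a s ih =>
    obtain ⟨c, hc, h⟩ := ih fun l hl => hs l (by simp [hl])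
    refine ⟨min a c, lt_min (hs a (by simp)) hc, fun l hl => ?_⟩
    rcases Multiset.mem_cons.1 hl with rfl | hl
    · exact min_le_left _ _
    · exact (min_le_right _ _).trans (h l hl)

theorem exists_pos_ge (s : Multiset ℝ) : ∃ c > 0, ∀ l ∈ s, l < c := by
  induction s using Multiset.induction_on with
  | empty => exact ⟨1, one_pos, by simp⟩
  | cons a s ih =>
    obtain ⟨c, hc, h⟩ := ih
    refine ⟨max (a + 1) c, lt_max_of_lt_right hc, fun l hl => ?_⟩
    rcases Multiset.mem_cons.1 hl with rfl | hl
    · exact lt_max_of_lt_left (by linarith)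
    · exact lt_max_of_lt_right (h l hl)

/-- The degree of `t ↦ h (x + t • v)` does not depend on the point `x` of the open cone. -/
theorem natDegree_line_eq_rk (hd : h.IsHomogeneous d) (hh : IsHyperbolic h e) {x v : Fin n → ℝ}
    (hx : x ∈ openCone h e) (hv : v ∈ closedCone h e) :
    (line h x v).natDegree = rk h e v := by
  rw [← natDegree_line_self hd hh]
  refine le_antisymm ?_ ?_
  · obtain ⟨c, hc, hcl⟩ := exists_pos_ge (eigenvalues h e x)
    refine natDegree_line_le_of_sub_mem hd hh hx hv hc ((mem_openCone hd hh).2 fun t ht h0 => ?_)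
    have := hcl (c + t) ((mem_eigenvalues hd hh).2 (by
      rw [show x - (c + t) • e = (-1 : ℝ) • (c • e - x + t • e) by module,
        eval_smul_of_isHomogeneous hd, h0, mul_zero]))
    linarith
  · obtain ⟨c, hc, hcl⟩ := exists_pos_le_of_forall_pos (eigenvalues h e x) hx
    -- As c bounds the eigenvalues of x from below, those of (2/c) x - e are at least 1; the factor
    -- 2 gives strict positivity.
    refine natDegree_line_le_of_sub_mem hd hh (mem_openCone_self hd hh) hv (c := 2 / c)
      (by positivity) ((mem_openCone hd hh).2 fun t ht h0 => ?_)
    have := hcl (c / 2 * (1 - t)) ((mem_eigenvalues hd hh).2 (by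
      rw [show x - (c / 2 * (1 - t)) • e = (c / 2) • ((2 / c) • x - e + t • e) by
        rw [smul_add, smul_sub, smul_smul, show c / 2 * (2 / c) = 1 by field_simp]; module,
        eval_smul_of_isHomogeneous hd, h0, mul_zero]))
    nlinarith

theorem eval_lineDeriv_eq (a w : Fin n → ℝ) :
    eval a (lineDeriv w h) = (line h a w).derivative.eval 0 := by
  rw [derivative_line, eval_line, zero_smul, add_zero]

theorem roots_line_neg (hd : h.IsHomogeneous d) (hh : IsHyperbolic h e) {a w : Fin n → ℝ}
    (ha : a ∈ openCone h e) (hw : w ∈ closedCone h e) {ρ : ℝ} (hρ : ρ ∈ (line h a w).roots) :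
    ρ < 0 := by
  by_contra hcon
  exact eval_line_ne_zero hd hh ha hw (not_lt.1 hcon) (Polynomial.mem_roots'.1 hρ).2

theorem eval_lineDeriv_div_pos (hd : h.IsHomogeneous d) (hh : IsHyperbolic h e)
    {a w : Fin n → ℝ} (ha : a ∈ openCone h e) (hw : w ∈ closedCone h e) (hrk : 0 < rk h e w) :
    0 < eval a (lineDeriv w h) / eval a h := by
  have h0 := eval_line_ne_zero hd hh ha hw le_rfl
  have hs := splits_line hd hh ha w
  have h1 := hs.eval_derivative_div_eval_of_ne_zero h0
  rw [← eval_lineDeriv_eq, eval_line, zero_smul, add_zero] at h1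
  rw [h1]
  rw [← natDegree_line_eq_rk hd hh ha hw, hs.natDegree_eq_card_roots] at hrk
  obtain ⟨ρ, hρ⟩ := Multiset.card_pos_iff_exists_mem.1 hrk
  obtain ⟨s, hs'⟩ := Multiset.exists_cons_of_mem hρ
  have hpos : ∀ σ ∈ (line h a w).roots, 0 < 1 / (0 - σ) := fun σ hσ => by
    have := roots_line_neg hd hh ha hw hσ
    exact one_div_pos.2 (by linarith)
  rw [hs'] at hpos ⊢
  rw [Multiset.map_cons, Multiset.sum_cons]
  refine add_pos_of_pos_of_nonneg (hpos ρ (by simp)) (Multiset.sum_nonneg fun y hy => ?_)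
  obtain ⟨σ, hσ, rfl⟩ := Multiset.mem_map.1 hy
  exact (hpos σ (by simp [hσ])).le

theorem one_add_sum_le_prod (s : Multiset ℝ) (hs : ∀ b ∈ s, 0 ≤ b) :
    0 ≤ s.sum ∧ 1 + s.sum ≤ (s.map fun b => 1 + b).prod := by
  induction s using Multiset.induction_on with
  | empty => simp
  | cons b s ih =>
    obtain ⟨h1, h2⟩ := ih fun b hb => hs b (by simp [hb])
    have hb := hs b (by simp)
    simp only [Multiset.sum_cons, Multiset.map_cons, Multiset.prod_cons]
    refine ⟨by linarith, ?_⟩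
    nlinarith [mul_nonneg hb h1]

/-- Over the negative roots ρ of s ↦ h(a + s w), D_w h(a)/h(a) = ∑ (-1/ρ) while h(a + w)/h(a) = ∏ (1
- 1/ρ), and the product dominates the sum. -/
theorem abs_eval_lineDeriv_le (hd : h.IsHomogeneous d) (hh : IsHyperbolic h e)
    {a w : Fin n → ℝ} (ha : a ∈ openCone h e) (hw : w ∈ closedCone h e) :
    |eval a (lineDeriv w h)| ≤ |eval (a + w) h| := by
  have h0 := eval_line_ne_zero hd hh ha hw le_rfl
  have hs := splits_line hd hh ha w
  have h1 := hs.eval_derivative_div_eval_of_ne_zero h0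
  have e0 := hs.eval_eq_prod_roots 0
  have e1 := hs.eval_eq_prod_roots 1
  set R := (line h a w).roots with hR
  have hneg : ∀ ρ ∈ R, ρ < 0 := fun ρ hρ => roots_line_neg hd hh ha hw hρ
  obtain ⟨h2, h3⟩ := one_add_sum_le_prod (R.map fun z => 1 / (0 - z)) (fun b hb => by
    obtain ⟨σ, hσ, rfl⟩ := Multiset.mem_map.1 hb
    exact one_div_nonneg.2 (by linarith [hneg σ hσ]))
  have h4 : (R.map fun z => 1 - z).prod = (R.map fun z => 0 - z).prod *
      ((R.map fun z => 1 / (0 - z)).map fun b => 1 + b).prod := by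
    rw [Multiset.map_map, ← Multiset.prod_map_mul]
    congr 1
    refine Multiset.map_congr rfl fun ρ hρ => ?_
    have : 0 - ρ ≠ 0 := by linarith [hneg ρ hρ]
    simp only [Function.comp]
    field_simp
    ring
  rw [h4, ← mul_assoc, ← e0] at e1
  rw [div_eq_iff h0, ← eval_lineDeriv_eq] at h1
  have e1' : eval (a + w) h = (line h a w).eval 1 := by rw [eval_line, one_smul]
  rw [h1, e1', e1, mul_comm, abs_mul, abs_mul]
  refine mul_le_mul_of_nonneg_left ?_ (abs_nonneg _)
  rw [abs_of_nonneg h2]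
  exact le_trans (by linarith) (le_abs_self _)

/-- `abs_eval_lineDeriv_le` compares with the parallel line through x + w, on which h has the same
degree rk(v). -/
theorem natDegree_line_lineDeriv_le (hd : h.IsHomogeneous d) (hh : IsHyperbolic h e)
    {x v w : Fin n → ℝ} (hx : x ∈ openCone h e) (hv : v ∈ closedCone h e)
    (hw : w ∈ closedCone h e) :
    (line (lineDeriv w h) x v).natDegree ≤ (line h x v).natDegree := by
  rw [natDegree_line_eq_rk hd hh hx hv,
    ← natDegree_line_eq_rk hd hh (add_mem_openCone hd hh hx hw) hv]
  refine Polynomial.natDegree_le_natDegree (degree_le_of_abs_eval_le fun t ht => ?_)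
  rw [eval_line, eval_line, add_right_comm]
  exact abs_eval_lineDeriv_le hd hh (add_smul_mem_openCone hd hh hx hv ht) hw

theorem cev_ne_zero_of_im_mem_openCone (hd : h.IsHomogeneous d) (hh : IsHyperbolic h e)
    {y b : Fin n → ℝ} (hb : b ∈ openCone h e) : cev h (toC y + Complex.I • toC b) ≠ 0 :=
  cev_ne_zero_of_im_pos hd hh hb y (by simp)

/-- The logarithmic derivative at 0 is a sum of terms -1/σ over roots σ in the open lower
half-plane, each with negative imaginary part. -/
theorem derivative_mul_conj_im_nonpos {P : Polynomial ℂ} (hP : ∀ s : ℂ, 0 ≤ s.im → P.eval s ≠ 0) :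
    (P.derivative.eval 0 * (starRingEnd ℂ) (P.eval 0)).im ≤ 0 := by
  have h0 := hP 0 le_rfl
  have h1 := (IsAlgClosed.splits P).eval_derivative_div_eval_of_ne_zero h0
  have h2 : ((P.roots.map fun z => 1 / (0 - z)).sum).im ≤ 0 := by
    have hr : ∀ z ∈ P.roots, z.im < 0 := fun z hz => by
      by_contra hcon
      exact hP z (not_lt.1 hcon) (Polynomial.mem_roots'.1 hz).2
    generalize P.roots = R at hr
    induction R using Multiset.induction_on with
    | empty => simp
    | cons z R ih =>
      rw [Multiset.map_cons, Multiset.sum_cons, Complex.add_im]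
      have h3 := ih fun w hw => hr w (by simp [hw])
      have h4 := hr z (by simp)
      have h5 : (1 / (0 - z)).im ≤ 0 := by
        rw [one_div, Complex.inv_im]
        exact div_nonpos_of_nonpos_of_nonneg (by simp; exact h4.le) (Complex.normSq_nonneg _)
      linarith
  rw [div_eq_iff h0] at h1
  rw [h1, mul_assoc, Complex.mul_conj, Complex.im_mul_ofReal]
  exact mul_nonpos_of_nonpos_of_nonneg h2 (Complex.normSq_nonneg _)

/-- If v is in the open cone and Im z > 0, then x + z v + s w has imaginary part in the open cone
whenever Im s ≥ 0, so h has no zero there, and the logarithmic derivative in s at 0 is controlled. A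
general v is approximated by v + ε e. -/
theorem mapsDown_line (hd : h.IsHomogeneous d) (hh : IsHyperbolic h e) (x : Fin n → ℝ)
    {v w : Fin n → ℝ} (hv : v ∈ closedCone h e) (hw : w ∈ closedCone h e) :
    MapsDown (line h x v) (line (lineDeriv w h) x v) := by
  intro z hz
  rw [eval_map_line, eval_map_line]
  let F : ℝ → ℝ := fun ε => (cev (lineDeriv w h) (toC x + z • (toC v + (ε : ℂ) • toC e)) *
    (starRingEnd ℂ) (cev h (toC x + z • (toC v + (ε : ℂ) • toC e)))).im
  have hF : ∀ ε : ℝ, 0 < ε → F ε ≤ 0 := by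
    intro ε hε
    have hvε : v + ε • e ∈ openCone h e := by
      rw [add_comm]
      exact add_mem_openCone hd hh (smul_mem_openCone hd hh (mem_openCone_self hd hh) hε) hv
    have := derivative_mul_conj_im_nonpos
      (P := line (map Complex.ofRealHom h) (toC x + z • (toC v + (ε : ℂ) • toC e)) (toC w))
      (fun s hs => by
        rw [eval_line]
        have h1 := cev_ne_zero_of_im_mem_openCone hd hh (y := x + z.re • (v + ε • e) + s.re • w)
          (add_smul_mem_openCone hd hh (smul_mem_openCone hd hh hvε hz) hw hs)
        convert h1 using 1
        unfold cev
        congr 2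
        simp only [toC_add, toC_smul]
        conv_lhs => rw [← Complex.re_add_im z, ← Complex.re_add_im s]
        module)
    rw [derivative_line, eval_line, eval_line, ← map_lineDeriv, zero_smul, add_zero] at this
    exact this
  have hc : Continuous F := by
    refine Complex.continuous_im.comp (Continuous.mul ?_ (Complex.continuous_conj.comp ?_))
    · exact (continuous_cev _).comp (by fun_prop)
    · exact (continuous_cev _).comp (by fun_prop)
  have h0 : F 0 ≤ 0 := le_of_tendsto (x := 𝓝[>] (0 : ℝ))
    ((hc.tendsto 0).mono_left nhdsWithin_le_nhds)
    (eventually_mem_nhdsWithin.mono fun ε hε => hF ε hε)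
  simpa only [F, Complex.ofReal_zero, zero_smul, add_zero] using h0

end
end HypPoly

theorem lemma4p3 {n m : ℕ} (h : MvPolynomial (Fin n) ℝ) (e : Fin n → ℝ)
    (hh : HypPoly.IsHyperbolic h e)
    (v : Fin m → Fin n → ℝ) (hv : ∀ k, v k ∈ HypPoly.closedCone h e)
    (r : ℕ∞) (hr : 1 ≤ r) (δ μ : ℝ) (hU : (δ, μ) ∈ HypPoly.U r)
    (x : Fin n → ℝ) (hx : x ∈ HypPoly.openCone h e) (i j : Fin m)
    (hj0 : 0 < HypPoly.rk h e (v j)) (hjr : (HypPoly.rk h e (v j) : ℕ∞) ≤ r)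
    (hi0 : 0 < HypPoly.rk h e (v i))
    (hxi : HypPoly.xi (v j) h x ≥ μ) :
    MvPolynomial.eval x (HypPoly.dirDeriv (v i) h) ≠ 0 ∧
    MvPolynomial.eval (x + δ • v j)
      (HypPoly.dirDeriv (v i) (h - HypPoly.dirDeriv (v j) h)) ≠ 0 ∧
    HypPoly.xi (v i) (h - HypPoly.dirDeriv (v j) h) (x + δ • v j) ≥
      HypPoly.xi (v i) h x := by
  open HypPoly in
  obtain ⟨d, hd⟩ := hh.1
  have hδ := (pos_of_mem_U hU).1
  have hpos := eval_lineDeriv_div_pos hd hh hx (hv i) hi0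
  have hposδ := eval_lineDeriv_div_pos hd hh
    (add_smul_mem_openCone hd hh hx (hv j) hδ.le) (hv i) hi0
  have key := barrier_univariate (splits_line hd hh hx (v j))
    (fun t ht => eval_line_ne_zero hd hh hx (hv j) ht)
    (natDegree_line_lineDeriv_le hd hh hx (hv j) (hv i))
    (mapsDown_line hd hh x (hv j) (hv i)) hr
    (by rwa [natDegree_line_eq_rk hd hh hx (hv j)]) hU
    (by
      rw [← eval_lineDeriv_eq, eval_line, zero_smul, add_zero]
      exact hxi)
    (by simpa only [eval_line, zero_smul, add_zero] using hpos)
    (by simpa only [eval_line] using hposδ)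
  simp only [derivative_line, eval_line, zero_smul, add_zero, ← MvPolynomial.eval_sub] at key
  -- Differentiating g along the line gives ∂_j ∂_i h, whereas the goal contains ∂_i ∂_j h.
  rw [lineDeriv_comm (v j) (v i)] at key
  simp only [xi, dirDeriv_eq, lineDeriv_sub, map_sub] at key ⊢
  refine ⟨fun h0 => ?_, key.1, key.2⟩
  rw [h0, zero_div] at hpos
  exact hpos.false
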